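/- Theorem (uniqueness theorem). Let $l,m\ge 1$ and let $(P_0,\dots,P_m)$ be a Clifford system on $\mathbb R^{2l}$, that is, a tuple of symmetric endomorphisms of $\mathbb R^{2l}$ with $P_iP_j+P_jP_i=2\delta_{ij}\,\mathrm{Id}$ for all $i,j$. Put $m_1=m$, $m_2=l-m-1$ and assume $m_1\le m_2$. Equip the space of endomorphisms with $\langle A,B\rangle=\frac1{2l}\operatorname{Trace}(AB)$, let the Clifford sphere $\Sigma=\Sigma(P_0,\dots,P_m)$ be the unit sphere of $\operatorname{Span}\{P_0,\dots,P_m\}$, and let $E_+(A)$ denote the eigenspace of $A$ for the eigenvalue $+1$. Let $f$ be the restriction to the unit sphere $S^{2l-1}$ of $F(x)=\langle x,x\rangle^2-2\sum_{i=0}^m\langle P_ix,x\rangle^2$, let $M_-=f^{-1}(\{-1\})$, and let the isoparametric family of the system be the collection of hypersurfaces $\{f^{-1}(\{t\}) : -1<t<1\}$. (1) Let $P\in\Sigma$ and $y\in E_+(P)\cap S^{2l-1}$. Then $y\in M_-$ and $$E_+(P)=\mathbb R y\oplus \operatorname{Span}\bigcup_{N\in\perp_yM_-\setminus\{0\}}\ker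 S_N .$$ Here $\perp_yM_-$ is the normal space of $M_-$ in $S^{2l-1}$ at $y$, and $S_N:T_yM_-\to T_yM_-$, $S_Nv=-(\nabla_v\xi)^{\tan}$ for any smooth local normal field $\xi$ of $M_-$ with $\xi(y)=N$, is the second fundamental tensor; such fields exist and $S_N$ does not depend on the choice of $\xi$. (2) The set $\{E_+(P) : P\in\Sigma\}$ determines the Clifford sphere and the isoparametric family: if a Clifford system $(Q_0,\dots,Q_{m'})$, $m'\ge1$, on $\mathbb R^{2l}$ has the same set of eigenspaces $\{E_+(Q):Q\in\Sigma(Q_0,\dots,Q_{m'})\}$, then it has the same Clifford sphere and the same isoparametric family. (3) The isoparametric family determines the Clifford sphere: if $(Q_0,\dots,Q_{m'})$, $m'\ge 1$, is a Clifford system on $\mathbb R^{2l}$ with $m'\le l-m'-1$ and its isoparametric family is equal to that of $(P_0,\dots,P_m)$, then $\Sigma(Q_0,\dots,Q_{m'})=\Sigma(P_0,\dots,P_m)$. (4) The congruence class of the family determines the geometric equivalence class of the Clifford system: if $(Q_0,\dots,Q_{m'})$, $m'\ge 1$, is a Clifford system on $\mathbb R^{2l}$ with $m'\le l-m'-1$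 and some orthogonal transformation of $\mathbb R^{2l}$ carries the isoparametric family of $(P_0,\dots,P_m)$ onto that of $(Q_0,\dots,Q_{m'})$ (as collections of hypersurfaces), then $m'=m$ and the two systems are geometrically equivalent, that is, there are an orthogonal transformation $B$ of $\operatorname{Span}\{P_0,\dots,P_m\}$ and $A\in O(\mathbb R^{2l})$ with $Q_i=A\,B(P_i)\,A^t$ for all $i$. -/

import Mathlib

open scoped ContDiff Topology

namespace FKM

noncomputable section

/-- The Euclidean space `ℝ^{2l}`. -/
abbrev Euc (l : ℕ) : Type := EuclideanSpace ℝ (Fin (2 * l))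

/-! ### Clifford systems -/

/-- A (symmetric) Clifford system `(P_0, …, P_m)` on `ℝ^{2l}`, where `l` and `m` are positive. -/
structure IsCliffordSystem {l m : ℕ} (P : Fin (m + 1) → Module.End ℝ (Euc l)) : Prop where
  l_pos : 0 < l
  m_pos : 0 < m
  symmetric : ∀ i, (P i).IsSymmetric
  anticomm : ∀ i j, P i * P j + P j * P i = if i = j then 2 • (1 : Module.End ℝ (Euc l)) else 0

/-- The scalar product `⟨A, B⟩ = Trace (A B) / dim V` on endomorphisms of `V = ℝ^{2l}`. -/
def traceInner {l : ℕ} (A B : Module.End ℝ (Euc l)) : ℝ :=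
  LinearMap.trace ℝ (Euc l) (A * B) / (2 * l : ℝ)

/-- `Span {P_0, …, P_m}`. -/
def cliffordSpan {l m : ℕ} (P : Fin (m + 1) → Module.End ℝ (Euc l)) :
    Submodule ℝ (Module.End ℝ (Euc l)) :=
  Submodule.span ℝ (Set.range P)

/-- The Clifford sphere `Σ(P_0, …, P_m)`: the unit sphere of `Span {P_0, …, P_m}` with respect
to the scalar product `traceInner`. -/
def cliffordSphere {l m : ℕ} (P : Fin (m + 1) → Module.End ℝ (Euc l)) :
    Set (Module.End ℝ (Euc l)) :=
  {A | A ∈ cliffordSpan P ∧ traceInner A A = 1}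

/-- The eigenspace `E_+(A)` of the eigenvalue `+1`. -/
def Eplus {l : ℕ} (A : Module.End ℝ (Euc l)) : Submodule ℝ (Euc l) :=
  Module.End.eigenspace A 1

/-- Algebraic equivalence: `Q_i = A P_i A^t` for one orthogonal transformation `A`. -/
def AlgebraicallyEquivalent {l m : ℕ} (P Q : Fin (m + 1) → Module.End ℝ (Euc l)) : Prop :=
  ∃ A : Euc l ≃ₗᵢ[ℝ] Euc l, ∀ i x, Q i x = A (P i (A.symm x))

/-- Geometric equivalence: `(Q_i)` is algebraically equivalent to `(B(P_i))` for some orthogonal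
transformation `B` of `Span {P_0, …, P_m}`. -/
def GeometricallyEquivalent {l m : ℕ} (P Q : Fin (m + 1) → Module.End ℝ (Euc l)) : Prop :=
  ∃ B : cliffordSpan P ≃ₗ[ℝ] cliffordSpan P,
    (∀ X Y : cliffordSpan P,
      traceInner (B X : Module.End ℝ (Euc l)) (B Y : Module.End ℝ (Euc l))
        = traceInner (X : Module.End ℝ (Euc l)) (Y : Module.End ℝ (Euc l))) ∧
    AlgebraicallyEquivalent
      (fun i => (B ⟨P i, Submodule.subset_span (Set.mem_range_self i)⟩ : Module.End ℝ (Euc l))) Q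

/-! ### The isoparametric family -/

/-- `F(x) = ⟨x, x⟩² - 2 ∑ ⟨P_i x, x⟩²`. -/
def cartanPoly {l m : ℕ} (P : Fin (m + 1) → Module.End ℝ (Euc l)) (x : Euc l) : ℝ :=
  (inner ℝ x x) ^ 2 - 2 * ∑ i, (inner ℝ (P i x) x) ^ 2

/-- The level set `f⁻¹({t})` of the restriction `f` of `F` to the unit sphere `S^{2l-1}`. -/
def level {l m : ℕ} (P : Fin (m + 1) → Module.End ℝ (Euc l)) (t : ℝ) : Set (Euc l) :=
  {x | x ∈ Metric.sphere (0 : Euc l) 1 ∧ cartanPoly P x = t}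

/-- The focal manifold `M_- = f⁻¹({-1})`. -/
def Mminus {l m : ℕ} (P : Fin (m + 1) → Module.End ℝ (Euc l)) : Set (Euc l) :=
  level P (-1)

/-- The isoparametric family, as the unlabelled collection of the hypersurfaces `f⁻¹({t})`,
`-1 < t < 1`. -/
def isoFamily {l m : ℕ} (P : Fin (m + 1) → Module.End ℝ (Euc l)) : Set (Set (Euc l)) :=
  {M | ∃ t ∈ Set.Ioo (-1 : ℝ) 1, M = level P t}

/-- Two families of subsets of the sphere are congruent if an isometry of the sphere, that is, an
orthogonal transformation, carries the members of the first onto the members of the second. -/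
def Congruent {l : ℕ} (𝓕 𝓖 : Set (Set (Euc l))) : Prop :=
  ∃ A : Euc l ≃ₗᵢ[ℝ] Euc l, (fun M : Set (Euc l) => A '' M) '' 𝓕 = 𝓖

/-! ### Second fundamental tensors of a submanifold of the unit sphere -/

/-- The tangent space `T_y M`, generated by the velocities at `y` of the smooth curves in `M`
through `y` (for a smooth submanifold these velocities already form a linear space). -/
def tangentSpaceAt {l : ℕ} (M : Set (Euc l)) (y : Euc l) : Submodule ℝ (Euc l) :=
  Submodule.span ℝ
    {v | ∃ γ : ℝ → Euc l, ContDiff ℝ ∞ γ ∧ (∀ t, γ t ∈ M) ∧ γ 0 = y ∧ deriv γ 0 = v}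

/-- The normal space `⊥_y M` of `M` in the unit sphere: the vectors that are tangent to the sphere
at `y` (orthogonal to `y`) and orthogonal to `T_y M`. -/
def normalSpaceAt {l : ℕ} (M : Set (Euc l)) (y : Euc l) : Submodule ℝ (Euc l) :=
  (Submodule.span ℝ {y} ⊔ tangentSpaceAt M y)ᗮ

/-- `ξ` is a smooth local normal field of `M` (in the unit sphere) near `y` with `ξ(y) = N`. -/
structure IsNormalField {l : ℕ} (M : Set (Euc l)) (y N : Euc l) (ξ : Euc l → Euc l) : Prop where
  smooth : ContDiffAt ℝ ∞ ξ y
  normal : ∀ᶠ x in 𝓝[M] y, ξ x ∈ normalSpaceAt M x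
  value : ξ y = N

/-- The tensor `v ↦ -(∇_v ξ)^{tan}` on `T_y M`; the tangential component of the covariant
derivative in the sphere is that of the Euclidean derivative. -/
def weingarten {l : ℕ} (M : Set (Euc l)) (y : Euc l) (ξ : Euc l → Euc l) :
    tangentSpaceAt M y →ₗ[ℝ] tangentSpaceAt M y :=
  -((tangentSpaceAt M y).orthogonalProjectionOnto.toLinearMap ∘ₗ
      (fderiv ℝ ξ y).toLinearMap ∘ₗ (tangentSpaceAt M y).subtype)

open Classical in
/-- The second fundamental tensor `S_N` of `M` at `y` with respect to the normal vector `N`: the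
tensor `v ↦ -(∇_v ξ)^{tan}` for a smooth local normal field `ξ` with `ξ(y) = N` (on a smooth
submanifold such a field exists, and the choice is immaterial). -/
def secondFundamentalTensor {l : ℕ} (M : Set (Euc l)) (y N : Euc l) :
    tangentSpaceAt M y →ₗ[ℝ] tangentSpaceAt M y :=
  if h : ∃ ξ : Euc l → Euc l, IsNormalField M y N ξ then weingarten M y h.choose else 0

/-- The span of the union of the kernels of all `S_N`, `N ∈ ⊥_y M`, `N ≠ 0`, as a subspace of
`ℝ^{2l}`. -/
def kernelSpan {l : ℕ} (M : Set (Euc l)) (y : Euc l) : Submodule ℝ (Euc l) :=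
  Submodule.span ℝ
    (⋃ N ∈ {N : Euc l | N ∈ normalSpaceAt M y ∧ N ≠ 0},
      {v | ∃ w : tangentSpaceAt M y, secondFundamentalTensor M y N w = 0 ∧ (w : Euc l) = v})

end

end FKM

/-! For `y` in `M_-` put `P_y = ∑ ⟨P_i y, y⟩ P_i` (`momentEnd`). Equality in Cauchy–Schwarz gives
`P_y y = y`, so `M_-` is the union of the unit spheres of the spaces `E_+(P)`, `P ∈ Σ`, and `y`
determines `P` as `P_y`. Its tangent space at `y` is the part of `E_+(P_y) + Span {P_i y}`
orthogonal to `y`; the normal space is the part of `E_-(P_y)` orthogonal to all `P_i y`, of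
dimension at least `l - m`.

Differentiating the two equations that define normality pairs `∇_v ξ` with all tangent vectors in
terms of `N` alone. Hence `S_N` is well defined, and its kernel lies in `E_+(P_y)` and contains
every `v ⊥ y` in `E_+(P_y)` that is orthogonal to all `P_i N`. If a nonzero `z ⊥ y` in `E_+(P_y)`
were orthogonal to all these kernels, then `z ∈ Span {P_i N}`, hence `N ∈ Span {P_i z}`, for every
unit normal `N`. The normal space would be a proper subspace of a space of dimension at most `m +
1`, contrary to `m_1 ≤ m_2` (`eq_zero_of_orthogonal_kernelSpan`). This gives (1).

For (2), a symmetric involution is determined by its `+1` eigenspace, and `∑ ⟨P_i x, x⟩²` is the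
maximum of `⟨A x, x⟩²` over the Clifford sphere.

For (3), the family is unlabelled, so `F_Q` is only known to be constant on the levels of `F_P`.
Along a great circle normal to `M_-`, `F_P = 8 c² s² - 1`, while `F_Q` averaged over the symmetries
of the square is affine in `c² s²`. Thus `F_Q = a + b F_P`, and surjectivity onto `(-1, 1)` leaves
`F_Q = ± F_P`. The minus sign makes the two systems anticommute and forces `l = 2m + 1`; but a
product `P_1 Q_0` is then a complex structure on the `l`-dimensional space `E_+(P_0)`, so `l` would
be even (`not_cartanPoly_neg`). With the plus sign the manifolds `M_-` agree and (1) recovers the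
eigenspaces.

For (4), conjugating by the congruence reduces to (3); two Clifford systems with the same span
differ by an orthogonal change of basis. -/

namespace FKM

open scoped InnerProductSpace


/-! ### Algebra of Clifford systems: anticommutation, traces, eigenspaces -/

section Algebra

variable {l m : ℕ} {P : Fin (m + 1) → Module.End ℝ (Euc l)}

/-- The linear combination `∑ c_i P_i`. -/
noncomputable def comb (P : Fin (m + 1) → Module.End ℝ (Euc l)) (c : Fin (m + 1) → ℝ) :
    Module.End ℝ (Euc l) :=
  ∑ i, c i • P i

/-- The vector of the values `⟨P_i x, x⟩`. -/
noncomputable def moment (P : Fin (m + 1) → Module.End ℝ (Euc l)) (x : Euc l) :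
    Fin (m + 1) → ℝ :=
  fun i => ⟪P i x, x⟫_ℝ

theorem comb_apply (c : Fin (m + 1) → ℝ) (x : Euc l) : comb P c x = ∑ i, c i • P i x := by
  simp [comb, LinearMap.sum_apply]

theorem comb_single (i : Fin (m + 1)) : comb P (Pi.single i 1) = P i := by
  simp [comb, Pi.single_apply, ite_smul]

theorem inner_comb_left (c : Fin (m + 1) → ℝ) (x y : Euc l) :
    ⟪comb P c x, y⟫_ℝ = ∑ i, c i * ⟪P i x, y⟫_ℝ := by
  simp [comb_apply, sum_inner, real_inner_smul_left]

theorem inner_comb_right (c : Fin (m + 1) → ℝ) (x y : Euc l) :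
    ⟪y, comb P c x⟫_ℝ = ∑ i, c i * ⟪y, P i x⟫_ℝ := by
  simp [comb_apply, inner_sum, real_inner_smul_right]

theorem mem_cliffordSpan {A : Module.End ℝ (Euc l)} :
    A ∈ cliffordSpan P ↔ ∃ c, A = comb P c := by
  rw [cliffordSpan, Submodule.mem_span_range_iff_exists_fun]
  exact exists_congr fun c => eq_comm

theorem cartanPoly_eq (x : Euc l) :
    cartanPoly P x = ⟪x, x⟫_ℝ ^ 2 - 2 * ∑ i, moment P x i ^ 2 := rfl

namespace IsCliffordSystem

theorem inner_left (hP : IsCliffordSystem P) (i : Fin (m + 1)) (x y : Euc l) :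
    ⟪P i x, y⟫_ℝ = ⟪x, P i y⟫_ℝ := hP.symmetric i x y

theorem anticomm_apply (hP : IsCliffordSystem P) (i j : Fin (m + 1)) (x : Euc l) :
    P i (P j x) + P j (P i x) = if i = j then (2 : ℝ) • x else 0 := by
  have h := congrArg (fun T : Module.End ℝ (Euc l) => T x) (hP.anticomm i j)
  split_ifs at h ⊢ with hij
  · simpa [two_smul] using h
  · simpa using h

theorem sq_apply (hP : IsCliffordSystem P) (i : Fin (m + 1)) (x : Euc l) : P i (P i x) = x := by
  have h := hP.anticomm_apply i i x
  rw [if_pos rfl, ← two_smul ℝ] at h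
  exact smul_right_injective _ (two_ne_zero' ℝ) h

theorem inner_apply_apply (hP : IsCliffordSystem P) (i j : Fin (m + 1)) (x : Euc l) :
    ⟪P i x, P j x⟫_ℝ = if i = j then ⟪x, x⟫_ℝ else 0 := by
  split_ifs with hij
  · subst hij
    rw [hP.inner_left, hP.sq_apply]
  · have h := hP.anticomm_apply i j x
    rw [if_neg hij] at h
    have h2 : ⟪x, P i (P j x)⟫_ℝ + ⟪x, P j (P i x)⟫_ℝ = 0 := by
      rw [← inner_add_right, h, inner_zero_right]
    have h3 := hP.inner_left i x (P j x)
    have h4 := hP.inner_left j x (P i x)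
    have h5 := real_inner_comm (P i x) (P j x)
    linarith

theorem comb_inner_left (hP : IsCliffordSystem P) (c : Fin (m + 1) → ℝ) (x y : Euc l) :
    ⟪comb P c x, y⟫_ℝ = ⟪x, comb P c y⟫_ℝ := by
  simp only [inner_comb_left, inner_comb_right, hP.inner_left]

theorem comb_anticomm (hP : IsCliffordSystem P) (c d : Fin (m + 1) → ℝ) :
    comb P c * comb P d + comb P d * comb P c = (2 * ∑ i, c i * d i) • 1 := by
  have h1 : comb P c * comb P d = ∑ i, ∑ j, (c i * d j) • (P i * P j) := by
    simp only [comb, Finset.sum_mul_sum, smul_mul_smul_comm]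
  have h2 : comb P d * comb P c = ∑ i, ∑ j, (c i * d j) • (P j * P i) := by
    rw [Finset.sum_comm]
    simp only [comb, Finset.sum_mul_sum, smul_mul_smul_comm, mul_comm]
  rw [h1, h2, ← Finset.sum_add_distrib]
  simp only [← Finset.sum_add_distrib, ← smul_add, hP.anticomm, smul_ite, smul_zero,
    Finset.sum_ite_eq, Finset.mem_univ, if_true]
  rw [Finset.mul_sum, Finset.sum_smul]
  refine Finset.sum_congr rfl fun i _ => ?_
  rw [← Nat.cast_smul_eq_nsmul ℝ, smul_smul, Nat.cast_ofNat, mul_comm 2 (c i * d i)]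

theorem comb_anticomm_apply (hP : IsCliffordSystem P) (c d : Fin (m + 1) → ℝ) (x : Euc l) :
    comb P c (comb P d x) + comb P d (comb P c x) = (2 * ∑ i, c i * d i) • x :=
  congrArg (fun T : Module.End ℝ (Euc l) => T x) (hP.comb_anticomm c d)

theorem comb_sq_apply (hP : IsCliffordSystem P) (c : Fin (m + 1) → ℝ) (x : Euc l) :
    comb P c (comb P c x) = (∑ i, c i ^ 2) • x := by
  have h := hP.comb_anticomm_apply c c x
  rw [← two_smul ℝ, mul_smul] at h
  simpa [sq] using smul_right_injective _ (two_ne_zero' ℝ) h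

theorem inner_comb_apply (hP : IsCliffordSystem P) (i : Fin (m + 1)) (c : Fin (m + 1) → ℝ)
    (x : Euc l) : ⟪P i x, comb P c x⟫_ℝ = c i * ⟪x, x⟫_ℝ := by
  simp [inner_comb_right, hP.inner_apply_apply]

theorem inner_comb_comb (hP : IsCliffordSystem P) (c d : Fin (m + 1) → ℝ)
    (x : Euc l) : ⟪comb P c x, comb P d x⟫_ℝ = (∑ i, c i * d i) * ⟪x, x⟫_ℝ := by
  simp [inner_comb_left, hP.inner_comb_apply, Finset.sum_mul, mul_assoc]

/-- `comb P c` and `P i` anticommute up to a multiple of the identity. -/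
theorem comb_apply_apply (hP : IsCliffordSystem P) (i : Fin (m + 1)) (c : Fin (m + 1) → ℝ)
    (x : Euc l) : comb P c (P i x) + P i (comb P c x) = (2 * c i) • x := by
  have h := hP.comb_anticomm_apply c (Pi.single i 1) x
  rw [comb_single] at h
  simpa [Pi.single_apply] using h

theorem traceInner_comb (hP : IsCliffordSystem P) (c d : Fin (m + 1) → ℝ) :
    traceInner (comb P c) (comb P d) = ∑ i, c i * d i := by
  have h := congrArg (LinearMap.trace ℝ (Euc l)) (hP.comb_anticomm c d)
  rw [map_add, LinearMap.trace_mul_comm ℝ (comb P d), map_smul, LinearMap.trace_one] at h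
  have hl : (0 : ℝ) < l := Nat.cast_pos.2 hP.l_pos
  simp only [finrank_euclideanSpace, Fintype.card_fin, Nat.cast_mul, Nat.cast_ofNat,
    smul_eq_mul] at h
  rw [traceInner, div_eq_iff (by positivity)]
  linarith

theorem mem_cliffordSphere (hP : IsCliffordSystem P) {A : Module.End ℝ (Euc l)} :
    A ∈ cliffordSphere P ↔ ∃ c, ∑ i, c i ^ 2 = 1 ∧ A = comb P c := by
  constructor
  · rintro ⟨h1, h2⟩
    obtain ⟨c, rfl⟩ := mem_cliffordSpan.1 h1
    exact ⟨c, by simpa [hP.traceInner_comb, sq] using h2, rfl⟩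
  · rintro ⟨c, hc, rfl⟩
    exact ⟨mem_cliffordSpan.2 ⟨c, rfl⟩, by simpa [hP.traceInner_comb, sq] using hc⟩

theorem apply_mem_cliffordSphere (hP : IsCliffordSystem P) (i : Fin (m + 1)) :
    P i ∈ cliffordSphere P :=
  hP.mem_cliffordSphere.2 ⟨Pi.single i 1, by simp [Pi.single_apply], (comb_single i).symm⟩

theorem neg_mem_cliffordSphere (hP : IsCliffordSystem P) {A : Module.End ℝ (Euc l)}
    (hA : A ∈ cliffordSphere P) : -A ∈ cliffordSphere P := by
  obtain ⟨c, hc, rfl⟩ := hP.mem_cliffordSphere.1 hA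
  exact hP.mem_cliffordSphere.2 ⟨-c, by simpa using hc, by simp [comb]⟩

theorem sphere_inner_left (hP : IsCliffordSystem P) {A : Module.End ℝ (Euc l)}
    (hA : A ∈ cliffordSphere P) (x y : Euc l) : ⟪A x, y⟫_ℝ = ⟪x, A y⟫_ℝ := by
  obtain ⟨c, hc, rfl⟩ := hP.mem_cliffordSphere.1 hA
  exact hP.comb_inner_left c x y

theorem sphere_sq_apply (hP : IsCliffordSystem P) {A : Module.End ℝ (Euc l)}
    (hA : A ∈ cliffordSphere P) (x : Euc l) : A (A x) = x := by
  obtain ⟨c, hc, rfl⟩ := hP.mem_cliffordSphere.1 hA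
  rw [hP.comb_sq_apply, hc, one_smul]

/-- Conjugation by another `P j` turns `P i` into `-P i`. A second index exists because `m` is
positive. -/
theorem trace_apply (hP : IsCliffordSystem P) (i : Fin (m + 1)) :
    LinearMap.trace ℝ (Euc l) (P i) = 0 := by
  obtain ⟨j, hj⟩ : ∃ j : Fin (m + 1), j ≠ i := by
    have := hP.m_pos
    have : Nontrivial (Fin (m + 1)) := Fin.nontrivial_iff_two_le.2 (by omega)
    exact exists_ne i
  have h1 : P i = -(P j * (P i * P j)) := by
    ext1 x
    have h := hP.anticomm_apply i j (P j x)
    rw [if_neg hj.symm, hP.sq_apply] at h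
    simpa using eq_neg_of_add_eq_zero_left h
  have h2 : LinearMap.trace ℝ (Euc l) (P j * (P i * P j)) = LinearMap.trace ℝ (Euc l) (P i) := by
    rw [LinearMap.trace_mul_comm]
    congr 1
    ext1 x
    simp [hP.sq_apply]
  have h3 := congrArg (LinearMap.trace ℝ (Euc l)) h1
  rw [map_neg, h2] at h3
  linarith

theorem finrank_Eplus (hP : IsCliffordSystem P) {A : Module.End ℝ (Euc l)}
    (hA : A ∈ cliffordSphere P) : Module.finrank ℝ (Eplus A) = l := by
  -- The rank of the projection `(1 + A) / 2` is its trace, and `A` has trace zero.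
  have hp : LinearMap.IsProj (Eplus A) ((1 / 2 : ℝ) • (1 + A)) := by
    constructor
    · intro x
      rw [Eplus, Module.End.mem_eigenspace_iff]
      simp [hP.sphere_sq_apply hA, add_comm]
    · intro x hx
      rw [Eplus, Module.End.mem_eigenspace_iff, one_smul] at hx
      simp [hx, ← two_smul ℝ]
  have h := hp.trace
  have h0 : LinearMap.trace ℝ (Euc l) A = 0 := by
    obtain ⟨c, hc, rfl⟩ := hP.mem_cliffordSphere.1 hA
    simp [comb, map_sum, hP.trace_apply]
  rw [map_smul, map_add, h0, LinearMap.trace_one] at h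
  simp only [finrank_euclideanSpace, Fintype.card_fin, Nat.cast_mul, Nat.cast_ofNat,
    smul_eq_mul] at h
  have h' : (Module.finrank ℝ (Eplus A) : ℝ) = l := by linarith
  exact_mod_cast h'

end IsCliffordSystem

theorem mem_Eplus {A : Module.End ℝ (Euc l)} {x : Euc l} : x ∈ Eplus A ↔ A x = x := by
  rw [Eplus, Module.End.mem_eigenspace_iff, one_smul]

namespace IsCliffordSystem

theorem mem_Eplus_orthogonal (hP : IsCliffordSystem P) {A : Module.End ℝ (Euc l)}
    (hA : A ∈ cliffordSphere P) {x : Euc l} : x ∈ (Eplus A)ᗮ ↔ A x = -x := by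
  constructor
  · intro h
    have h1 : A x + x ∈ Eplus A := by
      rw [mem_Eplus, map_add, hP.sphere_sq_apply hA, add_comm]
    have h2 : ⟪A x + x, x⟫_ℝ = 0 := h _ h1
    have h3 : ⟪A x + x, A x + x⟫_ℝ = 0 := by
      rw [inner_add_right, h2, ← hP.sphere_inner_left hA, mem_Eplus.1 h1, h2, add_zero]
    exact eq_neg_of_add_eq_zero_left (inner_self_eq_zero.1 h3)
  · intro h u hu
    have h1 := hP.sphere_inner_left hA u x
    rw [mem_Eplus.1 hu, h, inner_neg_right] at h1
    linarith

/-- A symmetric involution is the reflection in its `+1` eigenspace: the `-1` eigenspace is the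
orthogonal complement. -/
theorem eq_of_Eplus_eq {m' : ℕ} {Q : Fin (m' + 1) → Module.End ℝ (Euc l)}
    (hP : IsCliffordSystem P) (hQ : IsCliffordSystem Q) {A B : Module.End ℝ (Euc l)}
    (hA : A ∈ cliffordSphere P) (hB : B ∈ cliffordSphere Q) (h : Eplus A = Eplus B) : A = B := by
  ext1 x
  have h1 : A x + x ∈ Eplus A := by
    rw [mem_Eplus, map_add, hP.sphere_sq_apply hA, add_comm]
  have h2 : A x - x ∈ (Eplus A)ᗮ := by
    rw [hP.mem_Eplus_orthogonal hA, map_sub, hP.sphere_sq_apply hA, neg_sub]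
  rw [h, mem_Eplus, map_add] at h1
  rw [h, hQ.mem_Eplus_orthogonal hB, map_sub] at h2
  have h3 : (2 : ℝ) • A x = (2 : ℝ) • B x := by
    have h4 : (B (A x) + B x) - (B (A x) - B x) = (A x + x) - -(A x - x) := by rw [h1, h2]
    rw [two_smul, two_smul]
    calc A x + A x = (A x + x) - -(A x - x) := by abel
      _ = (B (A x) + B x) - (B (A x) - B x) := h4.symm
      _ = _ := by abel
  exact smul_right_injective _ (two_ne_zero' ℝ) h3

/-- The sum is the maximum of `⟨A x, x⟩²` over the Clifford sphere, attained at the normalized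
moment vector, so it is monotone in the sphere. -/
theorem sum_moment_sq_le {m' : ℕ} {Q : Fin (m' + 1) → Module.End ℝ (Euc l)}
    (hP : IsCliffordSystem P) (hQ : IsCliffordSystem Q)
    (h : cliffordSphere P ⊆ cliffordSphere Q) (x : Euc l) :
    ∑ i, moment P x i ^ 2 ≤ ∑ i, moment Q x i ^ 2 := by
  set r := ∑ i, moment P x i ^ 2 with hr
  have hr0 : 0 ≤ r := Finset.sum_nonneg fun i _ => sq_nonneg _
  rcases hr0.eq_or_lt with h0 | h0
  · rw [← h0]
    exact Finset.sum_nonneg fun i _ => sq_nonneg _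
  have hs : 0 < √r := Real.sqrt_pos.2 h0
  have hs2 : √r ^ 2 = r := Real.sq_sqrt hr0
  have hA : comb P (fun i => moment P x i / √r) ∈ cliffordSphere P := by
    refine hP.mem_cliffordSphere.2 ⟨_, ?_, rfl⟩
    simp only [div_pow, hs2, ← Finset.sum_div]
    exact div_self h0.ne'
  obtain ⟨d, hd, hAd⟩ := hQ.mem_cliffordSphere.1 (h hA)
  have h1 : √r = ∑ i, d i * moment Q x i := by
    have h2 : ⟪comb Q d x, x⟫_ℝ = ∑ i, d i * moment Q x i := inner_comb_left _ _ _
    rw [← h2, ← hAd, inner_comb_left]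
    have h3 : ∀ i, moment P x i / √r * ⟪P i x, x⟫_ℝ = moment P x i ^ 2 / √r := fun i => by
      change _ * moment P x i = _
      ring
    simp only [h3, ← Finset.sum_div, ← hr]
    rw [eq_div_iff hs.ne', ← sq, hs2]
  calc r = (∑ i, d i * moment Q x i) ^ 2 := by rw [← h1, hs2]
    _ ≤ (∑ i, d i ^ 2) * ∑ i, moment Q x i ^ 2 := Finset.sum_mul_sq_le_sq_mul_sq _ _ _
    _ = _ := by rw [hd, one_mul]

theorem cartanPoly_eq_of_cliffordSphere_eq {m' : ℕ} {Q : Fin (m' + 1) → Module.End ℝ (Euc l)}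
    (hP : IsCliffordSystem P) (hQ : IsCliffordSystem Q)
    (h : cliffordSphere P = cliffordSphere Q) : cartanPoly P = cartanPoly Q := by
  ext x
  rw [cartanPoly_eq, cartanPoly_eq,
    (hP.sum_moment_sq_le hQ h.subset x).antisymm (hQ.sum_moment_sq_le hP h.superset x)]

theorem isoFamily_eq_of_cliffordSphere_eq {m' : ℕ} {Q : Fin (m' + 1) → Module.End ℝ (Euc l)}
    (hP : IsCliffordSystem P) (hQ : IsCliffordSystem Q)
    (h : cliffordSphere P = cliffordSphere Q) : isoFamily P = isoFamily Q := by
  simp only [isoFamily, level, hP.cartanPoly_eq_of_cliffordSphere_eq hQ h]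

theorem cliffordSphere_subset_of_Eplus_image {m' : ℕ} {Q : Fin (m' + 1) → Module.End ℝ (Euc l)}
    (hP : IsCliffordSystem P) (hQ : IsCliffordSystem Q)
    (h : Eplus '' cliffordSphere P ⊆ Eplus '' cliffordSphere Q) :
    cliffordSphere P ⊆ cliffordSphere Q := by
  intro A hA
  obtain ⟨B, hB, hBA⟩ := h ⟨A, hA, rfl⟩
  rwa [hP.eq_of_Eplus_eq hQ hA hB hBA.symm]

end IsCliffordSystem

end Algebra


/-! ### Tangent and normal spaces of the focal manifold -/

section FocalManifold

variable {l m : ℕ} {P : Fin (m + 1) → Module.End ℝ (Euc l)}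

/-- The element `∑ ⟨P_i x, x⟩ P_i` of the Clifford span. -/
noncomputable def momentEnd (P : Fin (m + 1) → Module.End ℝ (Euc l)) (x : Euc l) :
    Module.End ℝ (Euc l) :=
  comb P (moment P x)

/-- The span of the vectors `P_i x`. -/
def orbitSpan (P : Fin (m + 1) → Module.End ℝ (Euc l)) (x : Euc l) : Submodule ℝ (Euc l) :=
  Submodule.span ℝ (Set.range fun i => P i x)

theorem mem_orbitSpan {x w : Euc l} : w ∈ orbitSpan P x ↔ ∃ d, comb P d x = w := by
  rw [orbitSpan, Submodule.mem_span_range_iff_exists_fun]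
  simp only [comb_apply]

theorem mem_orbitSpan_orthogonal {x w : Euc l} :
    w ∈ (orbitSpan P x)ᗮ ↔ ∀ i, ⟪w, P i x⟫_ℝ = 0 := by
  rw [Submodule.mem_orthogonal']
  constructor
  · exact fun h i => h _ (Submodule.subset_span ⟨i, rfl⟩)
  · intro h u hu
    obtain ⟨d, rfl⟩ := mem_orbitSpan.1 hu
    simp [inner_comb_right, h]

theorem mem_Mminus {x : Euc l} :
    x ∈ Mminus P ↔ ⟪x, x⟫_ℝ = 1 ∧ ∑ i, moment P x i ^ 2 = 1 := by
  have h1 : x ∈ Metric.sphere (0 : Euc l) 1 ↔ ⟪x, x⟫_ℝ = 1 := by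
    rw [mem_sphere_zero_iff_norm, real_inner_self_eq_norm_sq,
      pow_eq_one_iff_of_nonneg (norm_nonneg x) two_ne_zero]
  rw [Mminus, level, Set.mem_ofPred_eq, h1, cartanPoly_eq]
  refine and_congr_right fun h => ?_
  rw [h]
  constructor <;> intro h <;> linarith

namespace IsCliffordSystem

theorem moment_eq (hP : IsCliffordSystem P) {c : Fin (m + 1) → ℝ} {x : Euc l}
    (hx : ⟪x, x⟫_ℝ = 1) (h : comb P c x = x) : moment P x = c := by
  ext i
  have h1 := hP.inner_comb_apply i c x
  rwa [h, hx, mul_one] at h1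

theorem mem_Mminus_of_comb (hP : IsCliffordSystem P) {c : Fin (m + 1) → ℝ} {x : Euc l}
    (hx : ⟪x, x⟫_ℝ = 1) (hc : ∑ i, c i ^ 2 = 1) (h : comb P c x = x) : x ∈ Mminus P :=
  mem_Mminus.2 ⟨hx, by rw [hP.moment_eq hx h, hc]⟩

theorem momentEnd_mem (hP : IsCliffordSystem P) {x : Euc l} (hx : x ∈ Mminus P) :
    momentEnd P x ∈ cliffordSphere P :=
  hP.mem_cliffordSphere.2 ⟨_, (mem_Mminus.1 hx).2, rfl⟩

/-- Equality case of Cauchy–Schwarz: `x` and its image are unit vectors with inner product 1. -/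
theorem momentEnd_apply_self (hP : IsCliffordSystem P) {x : Euc l} (hx : x ∈ Mminus P) :
    momentEnd P x x = x := by
  obtain ⟨h1, h2⟩ := mem_Mminus.1 hx
  have h3 : ⟪momentEnd P x x, x⟫_ℝ = 1 := by
    rw [momentEnd, inner_comb_left, ← h2]
    exact Finset.sum_congr rfl fun i _ => (sq _).symm
  have h4 : ⟪momentEnd P x x, momentEnd P x x⟫_ℝ = 1 := by
    rw [momentEnd, hP.inner_comb_comb, h1, mul_one, ← h2]
    exact Finset.sum_congr rfl fun i _ => (sq _).symm
  have h5 : ⟪momentEnd P x x - x, momentEnd P x x - x⟫_ℝ = 0 := by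
    rw [inner_sub_left, inner_sub_right, inner_sub_right, real_inner_comm _ x, h3, h4, h1]
    norm_num
  exact sub_eq_zero.1 (inner_self_eq_zero.1 h5)

theorem momentEnd_apply_apply (hP : IsCliffordSystem P) (i : Fin (m + 1)) (x u : Euc l) :
    momentEnd P x (P i u) + P i (momentEnd P x u) = (2 * moment P x i) • u :=
  hP.comb_apply_apply i _ u

theorem inner_self_mem {x : Euc l} (hx : x ∈ Mminus P) :
    ⟪x, x⟫_ℝ = 1 := (mem_Mminus.1 hx).1

theorem inner_apply_of_mem_Eplus (hP : IsCliffordSystem P) {x : Euc l} (hx : x ∈ Mminus P)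
    (i : Fin (m + 1)) {e : Euc l} (he : momentEnd P x e = e) :
    ⟪P i x, e⟫_ℝ = moment P x i * ⟪x, e⟫_ℝ := by
  have h1 := congrArg (fun u => ⟪u, e⟫_ℝ) (hP.momentEnd_apply_apply i x x)
  simp only [inner_add_left, hP.momentEnd_apply_self hx, real_inner_smul_left] at h1
  rw [hP.sphere_inner_left (hP.momentEnd_mem hx), he] at h1
  linarith

theorem self_mem_orbitSpan (hP : IsCliffordSystem P) {x : Euc l} (hx : x ∈ Mminus P) :
    x ∈ orbitSpan P x :=
  mem_orbitSpan.2 ⟨moment P x, hP.momentEnd_apply_self hx⟩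

theorem self_mem_Eplus (hP : IsCliffordSystem P) {x : Euc l} (hx : x ∈ Mminus P) :
    x ∈ Eplus (momentEnd P x) :=
  mem_Eplus.2 (hP.momentEnd_apply_self hx)

end IsCliffordSystem

theorem _root_.HasDerivAt.end_apply {V : Type*} [NormedAddCommGroup V] [NormedSpace ℝ V]
    [FiniteDimensional ℝ V] (T : Module.End ℝ V) {γ : ℝ → V} {v : V} {t : ℝ}
    (h : HasDerivAt γ v t) : HasDerivAt (fun s => T (γ s)) (T v) t :=
  (LinearMap.toContinuousLinearMap T).hasFDerivAt.comp_hasDerivAt t h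

theorem hasDerivAt_circle {V : Type*} [NormedAddCommGroup V] [NormedSpace ℝ V] (y u : V) :
    HasDerivAt (fun t : ℝ => Real.cos t • y + Real.sin t • u) u 0 := by
  simpa using ((Real.hasDerivAt_cos 0).smul_const y).fun_add ((Real.hasDerivAt_sin 0).smul_const u)

theorem mem_tangentSpaceAt_of_circle {M : Set (Euc l)} {y u : Euc l}
    (h : ∀ t : ℝ, Real.cos t • y + Real.sin t • u ∈ M) : u ∈ tangentSpaceAt M y := by
  refine Submodule.subset_span ⟨fun t => Real.cos t • y + Real.sin t • u, ?_, h, by simp,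
    (hasDerivAt_circle y u).deriv⟩
  exact (Real.contDiff_cos.smul contDiff_const).add (Real.contDiff_sin.smul contDiff_const)

theorem inner_circle {y u : Euc l} (hy : ⟪y, y⟫_ℝ = 1) (hu : ⟪u, u⟫_ℝ = 1) (hyu : ⟪y, u⟫_ℝ = 0)
    {c s : ℝ} (hcs : c ^ 2 + s ^ 2 = 1) : ⟪c • y + s • u, c • y + s • u⟫_ℝ = 1 := by
  simp only [inner_add_left, inner_add_right, real_inner_smul_left, real_inner_smul_right,
    real_inner_comm y u, hy, hu, hyu]
  linarith

/-- A subspace that contains the unit vectors of another subspace contains that subspace. -/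
theorem mem_of_normalized {V : Type*} [NormedAddCommGroup V] [InnerProductSpace ℝ V]
    {S W : Submodule ℝ V} (h : ∀ u ∈ S, ⟪u, u⟫_ℝ = 1 → u ∈ W) : S ≤ W := by
  intro u hu
  rcases eq_or_ne u 0 with rfl | h0
  · exact W.zero_mem
  · have hn : ‖u‖ ≠ 0 := norm_ne_zero_iff.2 h0
    have h1 : ‖u‖⁻¹ • u ∈ W := h _ (S.smul_mem _ hu) (by
      rw [real_inner_smul_left, real_inner_smul_right, real_inner_self_eq_norm_sq]
      field_simp)
    simpa [smul_smul, hn] using W.smul_mem ‖u‖ h1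

namespace IsCliffordSystem

/-- Both equations are derivatives at 0 of identities along the curve: `⟨γ, γ⟩ = 1` and `momentEnd P
γ γ = γ`. -/
theorem velocity_eq (hP : IsCliffordSystem P) {γ : ℝ → Euc l} {y v : Euc l}
    (hγ : ∀ t, γ t ∈ Mminus P) (h0 : γ 0 = y) (hv : HasDerivAt γ v 0) :
    ⟪y, v⟫_ℝ = 0 ∧ comb P (fun i => 2 * ⟪P i y, v⟫_ℝ) y + momentEnd P y v = v := by
  constructor
  · have h1 := hv.inner ℝ hv
    have h2 : (fun t => ⟪γ t, γ t⟫_ℝ) = fun _ => 1 := funext fun t => inner_self_mem (hγ t)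
    rw [h2, h0, real_inner_comm v y] at h1
    have h3 := h1.unique (hasDerivAt_const 0 1)
    linarith [real_inner_comm v y]
  · have h1 : HasDerivAt (fun t => ∑ i, ⟪P i (γ t), γ t⟫_ℝ • P i (γ t))
        (∑ i, (⟪P i (γ 0), γ 0⟫_ℝ • P i v + (⟪P i (γ 0), v⟫_ℝ + ⟪P i v, γ 0⟫_ℝ) • P i (γ 0))) 0 :=
      HasDerivAt.fun_sum fun i _ => ((hv.end_apply (P i)).inner ℝ hv).smul (hv.end_apply (P i))
    have h2 : (fun t => ∑ i, ⟪P i (γ t), γ t⟫_ℝ • P i (γ t)) = γ := by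
      ext1 t
      rw [← comb_apply]
      exact hP.momentEnd_apply_self (hγ t)
    rw [h2, h0] at h1
    refine Eq.trans ?_ (h1.unique hv)
    rw [Finset.sum_add_distrib, add_comm, momentEnd, comb_apply, comb_apply]
    congr 1
    refine Finset.sum_congr rfl fun i _ => ?_
    rw [hP.inner_left i v y, real_inner_comm (P i y) v, ← two_mul]

theorem tangentSpaceAt_Mminus (hP : IsCliffordSystem P) {y : Euc l} (hy : y ∈ Mminus P) :
    tangentSpaceAt (Mminus P) y =
      (Submodule.span ℝ {y})ᗮ ⊓ (Eplus (momentEnd P y) ⊔ orbitSpan P y) := by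
  have hyy := inner_self_mem hy
  have hA := hP.momentEnd_mem hy
  have hAy := hP.momentEnd_apply_self hy
  apply le_antisymm
  · rw [tangentSpaceAt, Submodule.span_le]
    rintro v ⟨γ, hγ, hM, h0, hv⟩
    have hd : HasDerivAt γ v 0 := by
      rw [← hv]
      exact (hγ.differentiable (by simp)).differentiableAt.hasDerivAt
    obtain ⟨h1, h2⟩ := hP.velocity_eq hM h0 hd
    refine ⟨Submodule.mem_orthogonal_singleton_iff_inner_right.2 h1, ?_⟩
    -- The first summand is the projection of `v` to `E_+`; the second is its `E_-` part, which
    -- `velocity_eq` places in the orbit span.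
    have h3 : v = (1 / 2 : ℝ) • (v + momentEnd P y v) +
        (1 / 2 : ℝ) • comb P (fun i => 2 * ⟪P i y, v⟫_ℝ) y := by
      rw [eq_sub_of_add_eq h2]
      module
    rw [h3]
    refine Submodule.add_mem_sup (Submodule.smul_mem _ _ ?_)
      (Submodule.smul_mem _ _ (mem_orbitSpan.2 ⟨_, rfl⟩))
    rw [mem_Eplus, map_add, hP.sphere_sq_apply hA, add_comm]
  · have hE : (Submodule.span ℝ {y})ᗮ ⊓ Eplus (momentEnd P y) ≤ tangentSpaceAt (Mminus P) y := by
      refine mem_of_normalized fun u hu huu => mem_tangentSpaceAt_of_circle fun t => ?_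
      obtain ⟨h1, h2⟩ := hu
      rw [SetLike.mem_coe, Submodule.mem_orthogonal_singleton_iff_inner_right] at h1
      refine hP.mem_Mminus_of_comb (inner_circle hyy huu h1 (Real.cos_sq_add_sin_sq t))
        (mem_Mminus.1 hy).2 ?_
      change momentEnd P y _ = _
      rw [map_add, map_smul, map_smul, hAy, mem_Eplus.1 h2]
    have hU : ∀ d : Fin (m + 1) → ℝ, ∑ i, d i * moment P y i = 0 →
        comb P d y ∈ tangentSpaceAt (Mminus P) y := by
      intro d hd
      have key : ∀ d : Fin (m + 1) → ℝ, ∑ i, d i * moment P y i = 0 → ∑ i, d i ^ 2 = 1 →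
          comb P d y ∈ tangentSpaceAt (Mminus P) y := by
        intro d hd hdd
        have hn : ⟪comb P d y, comb P d y⟫_ℝ = 1 := by
          rw [hP.inner_comb_comb, hyy, mul_one, ← hdd]
          exact Finset.sum_congr rfl fun i _ => (sq _).symm
        have ho : ⟪y, comb P d y⟫_ℝ = 0 := by
          rw [← hP.comb_inner_left, inner_comb_left]
          exact hd
        refine mem_tangentSpaceAt_of_circle fun t => ?_
        -- With `D = comb P d` orthogonal to `P_y`, the point `cos t y + sin t D y` is fixed by `cos
        -- 2t P_y + sin 2t D`: the angle doubles because `P_y` and `D` act on the plane of `y` and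
        -- `D y` as reflections.
        refine hP.mem_Mminus_of_comb (c := fun i => Real.cos (2 * t) * moment P y i +
          Real.sin (2 * t) * d i) (inner_circle hyy hn ho (Real.cos_sq_add_sin_sq t)) ?_ ?_
        · calc _ = Real.cos (2 * t) ^ 2 * ∑ i, moment P y i ^ 2
              + 2 * Real.cos (2 * t) * Real.sin (2 * t) * ∑ i, d i * moment P y i
              + Real.sin (2 * t) ^ 2 * ∑ i, d i ^ 2 := by
                simp only [Finset.mul_sum, ← Finset.sum_add_distrib]
                exact Finset.sum_congr rfl fun i _ => by ring
            _ = 1 := by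
                rw [hd, hdd, (mem_Mminus.1 hy).2]
                linarith [Real.cos_sq_add_sin_sq (2 * t)]
        · have hc : comb P (fun i => Real.cos (2 * t) * moment P y i + Real.sin (2 * t) * d i)
              = Real.cos (2 * t) • momentEnd P y + Real.sin (2 * t) • comb P d := by
            simp only [momentEnd, comb, add_smul, mul_smul, Finset.sum_add_distrib,
              Finset.smul_sum]
          have hAd : momentEnd P y (comb P d y) = -comb P d y := by
            have h := hP.comb_anticomm_apply (moment P y) d y
            change momentEnd P y _ + comb P d (momentEnd P y y) = _ at h
            rw [hAy, Finset.sum_congr rfl fun i _ => mul_comm (moment P y i) (d i), hd,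
              mul_zero, zero_smul] at h
            exact eq_neg_of_add_eq_zero_left h
          have hdd' : comb P d (comb P d y) = y := by
            rw [hP.comb_sq_apply, hdd, one_smul]
          rw [hc]
          simp only [LinearMap.add_apply, LinearMap.smul_apply, map_add, map_smul, hAy, hAd, hdd']
          have e1 : Real.cos (2 * t) * Real.cos t + Real.sin (2 * t) * Real.sin t = Real.cos t := by
            rw [← Real.cos_sub]
            congr 1
            ring
          have e2 : Real.sin (2 * t) * Real.cos t - Real.cos (2 * t) * Real.sin t = Real.sin t := by
            rw [← Real.sin_sub]
            congr 1
            ring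
          match_scalars <;> linarith
      have hd0 : 0 ≤ ∑ i, d i ^ 2 := Finset.sum_nonneg fun i _ => sq_nonneg _
      rcases hd0.eq_or_lt with h0 | h0
      · have : comb P d y = 0 := by
          rw [← inner_self_eq_zero (𝕜 := ℝ), hP.inner_comb_comb]
          simp only [← sq, ← h0, zero_mul]
        rw [this]
        exact Submodule.zero_mem _
      · set r := ∑ i, d i ^ 2 with hr
        have hs : √r ≠ 0 := (Real.sqrt_pos.2 h0).ne'
        have h1 := key (fun i => d i / √r)
          (by simp only [div_mul_eq_mul_div, ← Finset.sum_div, hd, zero_div])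
          (by simp only [div_pow, Real.sq_sqrt hd0, ← Finset.sum_div, ← hr, div_self h0.ne'])
        have h2 : comb P d y = √r • comb P (fun i => d i / √r) y := by
          simp only [comb_apply, Finset.smul_sum, smul_smul, mul_div_cancel₀ _ hs]
        rw [h2]
        exact Submodule.smul_mem _ _ h1
    rintro v ⟨h1, h2⟩
    rw [SetLike.mem_coe, Submodule.mem_orthogonal_singleton_iff_inner_right] at h1
    obtain ⟨e, he, w, hw, rfl⟩ := Submodule.mem_sup.1 h2
    obtain ⟨d, rfl⟩ := mem_orbitSpan.1 hw
    set a := ∑ i, d i * moment P y i with ha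
    -- The vector `y` lies in both summands. Shifting `a • y` from one to the other makes each
    -- separately orthogonal to `y`.
    have h3 : e + comb P d y = (e + a • y) + comb P (fun i => d i - a * moment P y i) y := by
      have h4 : comb P (fun i => d i - a * moment P y i) y
          = comb P d y - a • momentEnd P y y := by
        simp only [momentEnd, comb_apply, sub_smul, mul_smul, Finset.sum_sub_distrib,
          Finset.smul_sum]
      rw [h4, hAy]
      abel
    have h5 : ⟪y, comb P d y⟫_ℝ = a := by
      rw [← hP.comb_inner_left, inner_comb_left]
      rfl
    rw [h3]
    refine Submodule.add_mem _ (hE ⟨?_, ?_⟩) (hU _ ?_)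
    · rw [SetLike.mem_coe, Submodule.mem_orthogonal_singleton_iff_inner_right, inner_add_right,
        real_inner_smul_right, hyy, ← h1, inner_add_right, h5, mul_one]
    · exact Submodule.add_mem _ he (Submodule.smul_mem _ _ (hP.self_mem_Eplus hy))
    · simp only [sub_mul, Finset.sum_sub_distrib, mul_assoc, ← Finset.mul_sum, ← sq,
        (mem_Mminus.1 hy).2, mul_one, ← ha, sub_self]

theorem normalSpaceAt_Mminus (hP : IsCliffordSystem P) {y : Euc l} (hy : y ∈ Mminus P) :
    normalSpaceAt (Mminus P) y = (Eplus (momentEnd P y) ⊔ orbitSpan P y)ᗮ := by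
  rw [normalSpaceAt, hP.tangentSpaceAt_Mminus hy,
    Submodule.sup_orthogonal_inf_of_hasOrthogonalProjection]
  rw [Submodule.span_le, Set.singleton_subset_iff]
  exact Submodule.mem_sup_left (hP.self_mem_Eplus hy)

theorem mem_normalSpaceAt (hP : IsCliffordSystem P) {y N : Euc l} (hy : y ∈ Mminus P) :
    N ∈ normalSpaceAt (Mminus P) y ↔ momentEnd P y N = -N ∧ ∀ i, ⟪N, P i y⟫_ℝ = 0 := by
  rw [hP.normalSpaceAt_Mminus hy, ← Submodule.inf_orthogonal, Submodule.mem_inf,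
    hP.mem_Eplus_orthogonal (hP.momentEnd_mem hy), mem_orbitSpan_orthogonal]

theorem finrank_orbitSpan_le (x : Euc l) : Module.finrank ℝ (orbitSpan P x) ≤ m + 1 := by
  have h := finrank_range_le_card (R := ℝ) (fun i => P i x)
  rwa [Fintype.card_fin] at h

/-- `E_+` has dimension `l`, the orbit span at most `m + 1`, and both contain `y`; so their sum has
dimension at most `l + m` inside a space of dimension `2l`. -/
theorem le_finrank_normalSpaceAt (hP : IsCliffordSystem P) {y : Euc l} (hy : y ∈ Mminus P) :
    l ≤ Module.finrank ℝ (normalSpaceAt (Mminus P) y) + m := by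
  rw [hP.normalSpaceAt_Mminus hy]
  set E := Eplus (momentEnd P y)
  set U := orbitSpan P y
  have h1 : Module.finrank ℝ E = l := hP.finrank_Eplus (hP.momentEnd_mem hy)
  have h2 : Module.finrank ℝ U ≤ m + 1 := finrank_orbitSpan_le y
  have h3 := Submodule.finrank_sup_add_finrank_inf_eq E U
  have h4 : 1 ≤ Module.finrank ℝ (E ⊓ U : Submodule ℝ (Euc l)) := by
    refine Submodule.one_le_finrank_iff.2 fun h => ?_
    have : y ∈ (E ⊓ U : Submodule ℝ (Euc l)) := ⟨hP.self_mem_Eplus hy, hP.self_mem_orbitSpan hy⟩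
    rw [h, Submodule.mem_bot] at this
    simpa [this] using inner_self_mem hy
  have h5 := (E ⊔ U).finrank_add_finrank_orthogonal
  rw [finrank_euclideanSpace, Fintype.card_fin] at h5
  omega

end IsCliffordSystem

end FocalManifold


/-! ### Second fundamental tensors of the focal manifold and their kernels -/

section SecondFundamentalTensor

variable {l m : ℕ} {P : Fin (m + 1) → Module.End ℝ (Euc l)}

namespace IsCliffordSystem

theorem isNormalField_curve {M : Set (Euc l)} {y N v : Euc l}
    {ξ : Euc l → Euc l} (hξ : IsNormalField M y N ξ) {γ : ℝ → Euc l} (hγ : ContDiff ℝ ∞ γ)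
    (hM : ∀ t, γ t ∈ M) (h0 : γ 0 = y) (hv : deriv γ 0 = v) :
    HasDerivAt γ v 0 ∧ HasDerivAt (fun t => ξ (γ t)) (fderiv ℝ ξ y v) 0 ∧
      ∀ᶠ t in 𝓝 (0 : ℝ), ξ (γ t) ∈ normalSpaceAt M (γ t) := by
  have hd : HasDerivAt γ v 0 := by
    rw [← hv]
    exact (hγ.differentiable (by simp)).differentiableAt.hasDerivAt
  refine ⟨hd, ?_, ?_⟩
  · have h1 : HasFDerivAt ξ (fderiv ℝ ξ y) (γ 0) := by
      rw [h0]
      exact (hξ.smooth.differentiableAt (by simp)).hasFDerivAt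
    exact h1.comp_hasDerivAt 0 hd
  · have h1 : Filter.Tendsto γ (𝓝 0) (𝓝[M] y) := by
      rw [← h0]
      exact tendsto_nhdsWithin_iff.2 ⟨hγ.continuous.continuousAt, Filter.Eventually.of_forall hM⟩
    exact h1.eventually hξ.normal

theorem mem_tangentSpaceAt (hP : IsCliffordSystem P) {y v : Euc l} (hy : y ∈ Mminus P) :
    v ∈ tangentSpaceAt (Mminus P) y ↔
      ⟪y, v⟫_ℝ = 0 ∧ ∃ e d, momentEnd P y e = e ∧ e + comb P d y = v := by
  rw [hP.tangentSpaceAt_Mminus hy, Submodule.mem_inf,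
    Submodule.mem_orthogonal_singleton_iff_inner_right, Submodule.mem_sup]
  simp only [mem_Eplus, mem_orbitSpan]
  refine and_congr_right fun _ => ⟨?_, ?_⟩
  · rintro ⟨e, he, _, ⟨d, rfl⟩, rfl⟩
    exact ⟨e, d, he, rfl⟩
  · rintro ⟨e, d, he, rfl⟩
    exact ⟨e, he, _, ⟨d, rfl⟩, rfl⟩

/-- A normal field satisfies `P_x ξ = -ξ` on `M_-`, so `⟨ξ, z⟩ + ⟨ξ, P_x z⟩` vanishes along curves
in `M_-`. Its derivative, with `P_y z = z`, is twice the asserted relation. Both sides are linear in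
`v`, so velocities of curves suffice. -/
theorem inner_fderiv_of_mem_Eplus (hP : IsCliffordSystem P) {y N : Euc l}
    {ξ : Euc l → Euc l} (hξ : IsNormalField (Mminus P) y N ξ) {v z : Euc l}
    (hv : v ∈ tangentSpaceAt (Mminus P) y) (hz : momentEnd P y z = z) :
    ⟪fderiv ℝ ξ y v, z⟫_ℝ = -∑ i, ⟪P i y, v⟫_ℝ * ⟪N, P i z⟫_ℝ := by
  induction hv using Submodule.span_induction with
  | mem v hv =>
    obtain ⟨γ, hγ, hM, h0, hv⟩ := hv
    obtain ⟨hd, hd', hn⟩ := isNormalField_curve hξ hγ hM h0 hv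
    have h1 : HasDerivAt (fun t => ⟪ξ (γ t), z⟫_ℝ +
        ∑ i, ⟪P i (γ t), γ t⟫_ℝ * ⟪ξ (γ t), P i z⟫_ℝ)
        (⟪fderiv ℝ ξ y v, z⟫_ℝ + ∑ i, ((⟪P i y, v⟫_ℝ + ⟪P i v, y⟫_ℝ) * ⟪N, P i z⟫_ℝ
          + ⟪P i y, y⟫_ℝ * ⟪fderiv ℝ ξ y v, P i z⟫_ℝ)) 0 := by
      have ha : ∀ u, HasDerivAt (fun t => ⟪ξ (γ t), u⟫_ℝ) ⟪fderiv ℝ ξ y v, u⟫_ℝ 0 := fun u => by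
        simpa using hd'.inner ℝ (hasDerivAt_const 0 u)
      refine (ha z).fun_add (HasDerivAt.fun_sum fun i _ => ?_)
      have h := ((hd.end_apply (P i)).inner ℝ hd).mul (ha (P i z))
      rw [h0, hξ.value] at h
      exact h
    have h2 : (fun t => ⟪ξ (γ t), z⟫_ℝ + ∑ i, ⟪P i (γ t), γ t⟫_ℝ * ⟪ξ (γ t), P i z⟫_ℝ)
        =ᶠ[𝓝 0] fun _ => 0 := by
      filter_upwards [hn] with t ht
      have h3 : ⟪ξ (γ t), momentEnd P (γ t) z⟫_ℝ
          = ∑ i, ⟪P i (γ t), γ t⟫_ℝ * ⟪ξ (γ t), P i z⟫_ℝ := inner_comb_right _ _ _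
      rw [← h3, ← hP.sphere_inner_left (hP.momentEnd_mem (hM t)),
        ((hP.mem_normalSpaceAt (hM t)).1 ht).1, inner_neg_left, add_neg_cancel]
    have h4 := (h1.congr_of_eventuallyEq h2.symm).unique (hasDerivAt_const 0 0)
    have h5 : ∑ i, ⟪P i y, y⟫_ℝ * ⟪fderiv ℝ ξ y v, P i z⟫_ℝ = ⟪fderiv ℝ ξ y v, z⟫_ℝ := by
      rw [← inner_comb_right]
      exact congrArg _ hz
    have h6 : ∀ i, (⟪P i y, v⟫_ℝ + ⟪P i v, y⟫_ℝ) * ⟪N, P i z⟫_ℝ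
        = 2 * (⟪P i y, v⟫_ℝ * ⟪N, P i z⟫_ℝ) := fun i => by
      rw [hP.inner_left i v y, real_inner_comm (P i y) v]
      ring
    rw [Finset.sum_add_distrib, h5, Finset.sum_congr rfl fun i _ => h6 i, ← Finset.mul_sum] at h4
    linarith
  | zero => simp
  | add v w _ _ hv hw =>
    simp only [map_add, inner_add_left, inner_add_right, hv, hw, add_mul, Finset.sum_add_distrib]
    ring
  | smul a v _ hv =>
    simp only [map_smul, real_inner_smul_left, real_inner_smul_right, hv, mul_assoc,
      ← Finset.mul_sum]
    ring

/-- Derivative of the other normality condition, `⟨ξ, comb P d x⟩ = 0` along `M_-`. -/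
theorem inner_fderiv_comb (hP : IsCliffordSystem P) {y N : Euc l}
    {ξ : Euc l → Euc l} (hξ : IsNormalField (Mminus P) y N ξ) {v : Euc l}
    (hv : v ∈ tangentSpaceAt (Mminus P) y) (d : Fin (m + 1) → ℝ) :
    ⟪fderiv ℝ ξ y v, comb P d y⟫_ℝ = -⟪N, comb P d v⟫_ℝ := by
  induction hv using Submodule.span_induction with
  | mem v hv =>
    obtain ⟨γ, hγ, hM, h0, hv⟩ := hv
    obtain ⟨hd, hd', hn⟩ := isNormalField_curve hξ hγ hM h0 hv
    have h1 := hd'.inner ℝ (hd.end_apply (comb P d))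
    rw [h0, hξ.value] at h1
    have h2 : (fun t => ⟪ξ (γ t), comb P d (γ t)⟫_ℝ) =ᶠ[𝓝 0] fun _ => 0 := by
      filter_upwards [hn] with t ht
      simp [inner_comb_right, ((hP.mem_normalSpaceAt (hM t)).1 ht).2]
    have h3 := (h1.congr_of_eventuallyEq h2.symm).unique (hasDerivAt_const 0 0)
    linarith
  | zero => simp
  | add v w _ _ hv hw =>
    simp only [map_add, inner_add_left, inner_add_right, hv, hw]
    ring
  | smul a v _ hv =>
    simp only [map_smul, real_inner_smul_left, real_inner_smul_right, hv]
    ring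

end IsCliffordSystem

/-- At the points `x` of `M_-` this is the orthogonal projection of `N` to the normal space. -/
noncomputable def normalPart (P : Fin (m + 1) → Module.End ℝ (Euc l)) (N x : Euc l) : Euc l :=
  (1 / 2 : ℝ) • (N - momentEnd P x N) -
    ∑ i, ⟪(1 / 2 : ℝ) • (N - momentEnd P x N), P i x⟫_ℝ • P i x

theorem contDiff_normalPart (N : Euc l) : ContDiff ℝ ∞ (normalPart P N) := by
  have h1 : ∀ i, ContDiff ℝ ∞ (fun x => P i x) := fun i => by
    have h := (LinearMap.toContinuousLinearMap (P i)).contDiff (n := ∞)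
    exact h
  have h2 : ContDiff ℝ ∞ (fun x => (1 / 2 : ℝ) • (N - momentEnd P x N)) := by
    refine ContDiff.const_smul _ (ContDiff.sub contDiff_const ?_)
    simp only [momentEnd, comb_apply, moment]
    exact ContDiff.sum fun i _ =>
      ((h1 i).inner ℝ contDiff_id).smul (contDiff_const (c := P i N))
  exact h2.sub (ContDiff.sum fun i _ => (h2.inner ℝ (h1 i)).smul (h1 i))

namespace IsCliffordSystem

theorem normalPart_mem (hP : IsCliffordSystem P) (N : Euc l) {x : Euc l} (hx : x ∈ Mminus P) :
    normalPart P N x ∈ normalSpaceAt (Mminus P) x := by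
  have hA := hP.momentEnd_mem hx
  set w := (1 / 2 : ℝ) • (N - momentEnd P x N) with hw
  have hAw : momentEnd P x w = -w := by
    rw [hw, map_smul, map_sub, hP.sphere_sq_apply hA, ← smul_neg, neg_sub]
  have he : normalPart P N x = w - comb P (fun i => ⟪w, P i x⟫_ℝ) x := by
    rw [normalPart, comb_apply]
  have hwx : ⟪w, x⟫_ℝ = 0 := by
    have h := hP.sphere_inner_left hA w x
    rw [hAw, hP.momentEnd_apply_self hx, inner_neg_left] at h
    linarith
  rw [hP.mem_normalSpaceAt hx, he]
  constructor
  -- The coefficients `⟨w, P_i x⟩` are orthogonal to the moment vector because `⟨w, x⟩ = 0`; hence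
  -- the subtracted vector also lies in `E_-`.
  · have h := hP.comb_anticomm_apply (moment P x) (fun i => ⟪w, P i x⟫_ℝ) x
    change momentEnd P x _ + comb P _ (momentEnd P x x) = _ at h
    rw [← inner_comb_right] at h
    change _ = (2 * ⟪w, momentEnd P x x⟫_ℝ) • x at h
    rw [hP.momentEnd_apply_self hx, hwx, mul_zero, zero_smul] at h
    rw [map_sub, hAw, eq_neg_of_add_eq_zero_left h]
    abel
  · intro i
    rw [inner_sub_left, real_inner_comm (P i x) (comb P _ x), hP.inner_comb_apply,
      inner_self_mem hx, mul_one, sub_self]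

theorem normalPart_eq_self (hP : IsCliffordSystem P) {y N : Euc l} (hy : y ∈ Mminus P)
    (hN : N ∈ normalSpaceAt (Mminus P) y) : normalPart P N y = N := by
  obtain ⟨h1, h2⟩ := (hP.mem_normalSpaceAt hy).1 hN
  have h3 : (1 / 2 : ℝ) • (N - momentEnd P y N) = N := by
    rw [h1]
    module
  simp only [normalPart, h3, h2, zero_smul, Finset.sum_const_zero, sub_zero]

theorem exists_isNormalField (hP : IsCliffordSystem P) {y N : Euc l} (hy : y ∈ Mminus P)
    (hN : N ∈ normalSpaceAt (Mminus P) y) : ∃ ξ, IsNormalField (Mminus P) y N ξ :=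
  ⟨normalPart P N, (contDiff_normalPart N).contDiffAt,
    eventually_nhdsWithin_of_forall fun _ hx => hP.normalPart_mem N hx,
    hP.normalPart_eq_self hy hN⟩

end IsCliffordSystem

theorem inner_weingarten {M : Set (Euc l)} {y : Euc l} (ξ : Euc l → Euc l)
    (v z : tangentSpaceAt M y) :
    ⟪weingarten M y ξ v, z⟫_ℝ = -⟪fderiv ℝ ξ y v, (z : Euc l)⟫_ℝ := by
  change ⟪-(tangentSpaceAt M y).orthogonalProjectionOnto (fderiv ℝ ξ y v), z⟫_ℝ = _
  rw [inner_neg_left, Submodule.inner_orthogonalProjectionOnto_eq_of_mem_right]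

namespace IsCliffordSystem

/-- The two derivative formulas involve the field only through `N`, and every tangent vector is a
sum of vectors to which they apply. -/
theorem weingarten_eq (hP : IsCliffordSystem P) {y N : Euc l} (hy : y ∈ Mminus P)
    {ξ η : Euc l → Euc l} (hξ : IsNormalField (Mminus P) y N ξ)
    (hη : IsNormalField (Mminus P) y N η) :
    weingarten (Mminus P) y ξ = weingarten (Mminus P) y η := by
  ext1 v
  refine ext_inner_right ℝ fun z => ?_
  rw [inner_weingarten, inner_weingarten]
  obtain ⟨-, e, d, he, hew⟩ := (hP.mem_tangentSpaceAt hy).1 z.2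
  rw [← hew, inner_add_right, inner_add_right,
    hP.inner_fderiv_of_mem_Eplus hξ v.2 he,
    hP.inner_fderiv_of_mem_Eplus hη v.2 he,
    hP.inner_fderiv_comb hξ v.2, hP.inner_fderiv_comb hη v.2]

theorem secondFundamentalTensor_eq (hP : IsCliffordSystem P) {y N : Euc l} (hy : y ∈ Mminus P)
    {ξ : Euc l → Euc l} (hξ : IsNormalField (Mminus P) y N ξ) :
    secondFundamentalTensor (Mminus P) y N = weingarten (Mminus P) y ξ := by
  have h : ∃ ξ : Euc l → Euc l, IsNormalField (Mminus P) y N ξ := ⟨ξ, hξ⟩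
  rw [secondFundamentalTensor, dif_pos h]
  exact hP.weingarten_eq hy h.choose_spec hξ

theorem comb_mem_Eplus (hP : IsCliffordSystem P) {y u : Euc l} (hu : momentEnd P y u = -u)
    {a : Fin (m + 1) → ℝ} (ha : ∑ i, moment P y i * a i = 0) :
    momentEnd P y (comb P a u) = comb P a u := by
  have h := hP.comb_anticomm_apply (moment P y) a u
  change momentEnd P y _ + comb P a (momentEnd P y u) = _ at h
  rw [hu, map_neg, ha, mul_zero, zero_smul, add_neg_eq_zero] at h
  exact h

/-- Pairing `S_N w` with the tangent vector `comb P a N`, where `a i = ⟨P_i y, w⟩`, gives `|a|²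
|N|²`. So `S_N w = 0` forces `a = 0`, which leaves only a multiple of `y` in the orbit part of `w`.
-/
theorem ker_secondFundamentalTensor_le (hP : IsCliffordSystem P) {y N : Euc l}
    (hy : y ∈ Mminus P) (hN : N ∈ normalSpaceAt (Mminus P) y) (hN0 : N ≠ 0)
    {w : tangentSpaceAt (Mminus P) y} (hw : secondFundamentalTensor (Mminus P) y N w = 0) :
    (w : Euc l) ∈ Eplus (momentEnd P y) := by
  obtain ⟨ξ, hξ⟩ := hP.exists_isNormalField hy hN
  rw [hP.secondFundamentalTensor_eq hy hξ] at hw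
  obtain ⟨h1, h2⟩ := (hP.mem_normalSpaceAt hy).1 hN
  obtain ⟨hyw, e, d, he, hew⟩ := (hP.mem_tangentSpaceAt hy).1 w.2
  set a : Fin (m + 1) → ℝ := fun i => ⟪P i y, (w : Euc l)⟫_ℝ with ha
  have ha0 : ∑ i, moment P y i * a i = 0 := by
    rw [← inner_comb_left]
    change ⟪momentEnd P y y, (w : Euc l)⟫_ℝ = 0
    rw [hP.momentEnd_apply_self hy, hyw]
  have hz : momentEnd P y (comb P a N) = comb P a N := hP.comb_mem_Eplus h1 ha0
  have hzT : comb P a N ∈ tangentSpaceAt (Mminus P) y := by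
    rw [hP.tangentSpaceAt_Mminus hy]
    refine ⟨?_, Submodule.mem_sup_left (mem_Eplus.2 hz)⟩
    rw [SetLike.mem_coe, Submodule.mem_orthogonal_singleton_iff_inner_left, hP.comb_inner_left,
      inner_comb_right]
    simp [h2]
  have h3 := inner_weingarten ξ w ⟨_, hzT⟩
  rw [hw, inner_zero_left, hP.inner_fderiv_of_mem_Eplus hξ w.2 hz, neg_neg] at h3
  have h4 : ∑ i, a i * ⟪N, P i (comb P a N)⟫_ℝ = (∑ i, a i * a i) * ⟪N, N⟫_ℝ := by
    rw [← inner_comb_right, ← hP.comb_inner_left, hP.inner_comb_comb]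
  have h5 : ∑ i, a i * a i = 0 := by
    have h6 := h3.trans h4
    rw [eq_comm, mul_eq_zero] at h6
    exact h6.resolve_right (inner_self_ne_zero.2 hN0)
  have h6 : ∀ i, a i = 0 := fun i => by
    have h := (Finset.sum_eq_zero_iff_of_nonneg fun i _ => mul_self_nonneg (a i)).1 h5 i
      (Finset.mem_univ i)
    exact mul_self_eq_zero.1 h
  have h7 : ∀ i, d i = -⟪y, e⟫_ℝ * moment P y i := fun i => by
    have h := h6 i
    rw [ha] at h
    simp only [← hew, inner_add_right, hP.inner_comb_apply, inner_self_mem hy,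
      hP.inner_apply_of_mem_Eplus hy i he] at h
    linarith
  have h8 : comb P d y = (-⟪y, e⟫_ℝ) • y := by
    nth_rewrite 3 [← hP.momentEnd_apply_self hy]
    simp only [momentEnd, comb_apply, h7, mul_smul, Finset.smul_sum]
  rw [← hew, h8]
  exact Submodule.add_mem _ (mem_Eplus.2 he) (Submodule.smul_mem _ _ (hP.self_mem_Eplus hy))

theorem mem_kernelSpan (hP : IsCliffordSystem P) {y N : Euc l}
    (hy : y ∈ Mminus P) (hN : N ∈ normalSpaceAt (Mminus P) y) (hN0 : N ≠ 0) {v : Euc l}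
    (hv : momentEnd P y v = v) (hyv : ⟪y, v⟫_ℝ = 0) (hNv : ∀ i, ⟪P i N, v⟫_ℝ = 0) :
    v ∈ kernelSpan (Mminus P) y := by
  obtain ⟨ξ, hξ⟩ := hP.exists_isNormalField hy hN
  have hvT : v ∈ tangentSpaceAt (Mminus P) y := by
    rw [hP.tangentSpaceAt_Mminus hy]
    exact ⟨Submodule.mem_orthogonal_singleton_iff_inner_right.2 hyv,
      Submodule.mem_sup_left (mem_Eplus.2 hv)⟩
  refine Submodule.subset_span (Set.mem_biUnion (x := N) ⟨hN, hN0⟩ ⟨⟨v, hvT⟩, ?_, rfl⟩)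
  rw [hP.secondFundamentalTensor_eq hy hξ]
  refine ext_inner_right ℝ fun z => ?_
  rw [inner_weingarten, inner_zero_left]
  obtain ⟨-, e, d, he, hew⟩ := (hP.mem_tangentSpaceAt hy).1 z.2
  rw [← hew, inner_add_right, hP.inner_fderiv_of_mem_Eplus hξ hvT he,
    hP.inner_fderiv_comb hξ hvT, inner_comb_right]
  simp [hP.inner_apply_of_mem_Eplus hy _ hv, hyv, ← hP.inner_left, hNv]

theorem kernelSpan_le (hP : IsCliffordSystem P) {y : Euc l} (hy : y ∈ Mminus P) :
    kernelSpan (Mminus P) y ≤ (Submodule.span ℝ {y})ᗮ ⊓ Eplus (momentEnd P y) := by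
  rw [kernelSpan, Submodule.span_le]
  refine Set.iUnion₂_subset ?_
  rintro N ⟨hN, hN0⟩ v ⟨w, hw, rfl⟩
  exact ⟨Submodule.mem_orthogonal_singleton_iff_inner_right.2
    ((hP.mem_tangentSpaceAt hy).1 w.2).1, hP.ker_secondFundamentalTensor_le hy hN hN0 hw⟩

theorem eq_zero_of_orthogonal_kernelSpan (hP : IsCliffordSystem P) (hm : 2 * m + 1 ≤ l)
    {y z : Euc l} (hy : y ∈ Mminus P) (hz : momentEnd P y z = z) (hyz : ⟪y, z⟫_ℝ = 0)
    (h : z ∈ (kernelSpan (Mminus P) y)ᗮ) : z = 0 := by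
  by_contra hz0
  have hle : normalSpaceAt (Mminus P) y ≤ orbitSpan P z := by
    refine mem_of_normalized fun N hN hNN => ?_
    have hN0 : N ≠ 0 := by
      rintro rfl
      simp at hNN
    obtain ⟨h1, h2⟩ := (hP.mem_normalSpaceAt hy).1 hN
    set d : Fin (m + 1) → ℝ := fun i => ⟪P i N, z⟫_ℝ with hd
    have hzN : ⟪N, z⟫_ℝ = 0 := by
      have h := hP.sphere_inner_left (hP.momentEnd_mem hy) N z
      rw [h1, hz, inner_neg_left] at h
      linarith
    have hd0 : ∑ i, moment P y i * d i = 0 := by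
      rw [← inner_comb_left]
      change ⟪momentEnd P y N, z⟫_ℝ = 0
      rw [h1, inner_neg_left, hzN, neg_zero]
    have hdE := hP.comb_mem_Eplus h1 hd0
    -- The `P_i N` are orthonormal, so `comb P d N` is the projection of `z` to their span and the
    -- remainder lies in the kernel of `S_N`. As `z` is orthogonal to that kernel, the remainder
    -- must vanish.
    have hv : z - comb P d N ∈ kernelSpan (Mminus P) y := by
      refine hP.mem_kernelSpan hy hN hN0 (by rw [map_sub, hz, hdE]) ?_ fun i => ?_
      · rw [inner_sub_right, hyz, ← hP.comb_inner_left, real_inner_comm, inner_comb_right]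
        simp [h2]
      · rw [inner_sub_right, hP.inner_comb_apply, hNN, mul_one, sub_self]
    have h3 : ⟪z - comb P d N, z⟫_ℝ = 0 := h _ hv
    have h4 : ⟪z - comb P d N, comb P d N⟫_ℝ = 0 := by
      rw [inner_comb_right]
      refine Finset.sum_eq_zero fun i _ => ?_
      rw [real_inner_comm, inner_sub_right, hP.inner_comb_apply, hNN, mul_one, sub_self, mul_zero]
    have h5 : z = comb P d N := by
      rw [← sub_eq_zero, ← inner_self_eq_zero (𝕜 := ℝ), inner_sub_right, h3, h4, sub_zero]
    have h6 : ∑ i, d i ^ 2 ≠ 0 := fun h0 => hz0 (by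
      rw [← inner_self_eq_zero (𝕜 := ℝ), h5, hP.inner_comb_comb]
      simp only [← sq, h0, zero_mul])
    refine mem_orbitSpan.2 ⟨fun i => d i / ∑ i, d i ^ 2, ?_⟩
    have h7 : comb P d z = (∑ i, d i ^ 2) • N := by
      nth_rewrite 1 [h5]
      exact hP.comb_sq_apply d N
    have h8 : comb P (fun i => d i / ∑ i, d i ^ 2) z = (∑ i, d i ^ 2)⁻¹ • comb P d z := by
      simp only [comb_apply, Finset.smul_sum, smul_smul, div_eq_inv_mul]
    rw [h8, h7, smul_smul, inv_mul_cancel₀ h6, one_smul]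
  have hzU : z ∈ orbitSpan P z := mem_orbitSpan.2 ⟨moment P y, hz⟩
  have hzn : z ∉ normalSpaceAt (Mminus P) y := fun hn => hz0 (by
    have h1 := ((hP.mem_normalSpaceAt hy).1 hn).1
    rw [hz] at h1
    have h2 : (2 : ℝ) • z = 0 := by
      rw [two_smul]
      nth_rewrite 2 [h1]
      exact add_neg_cancel z
    exact (smul_eq_zero.1 h2).resolve_left two_ne_zero)
  -- Strictness is what closes the count: the normal space has dimension at least `l - m ≥ m + 1`,
  -- the orbit span at most `m + 1`.
  have hlt : normalSpaceAt (Mminus P) y < orbitSpan P z :=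
    lt_of_le_of_ne hle fun he => hzn (he ▸ hzU)
  have h1 := Submodule.finrank_lt_finrank_of_lt hlt
  have h2 := hP.le_finrank_normalSpaceAt hy
  have h3 : Module.finrank ℝ (orbitSpan P z) ≤ m + 1 := finrank_orbitSpan_le z
  omega

theorem Eplus_eq_sup_kernelSpan (hP : IsCliffordSystem P) (hm : 2 * m + 1 ≤ l)
    {y : Euc l} (hy : y ∈ Mminus P) :
    Eplus (momentEnd P y) = Submodule.span ℝ {y} ⊔ kernelSpan (Mminus P) y := by
  have hle : Submodule.span ℝ {y} ⊔ kernelSpan (Mminus P) y ≤ Eplus (momentEnd P y) := by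
    refine sup_le ?_ ((hP.kernelSpan_le hy).trans inf_le_right)
    rw [Submodule.span_le, Set.singleton_subset_iff]
    exact hP.self_mem_Eplus hy
  refine le_antisymm ?_ hle
  rw [← Submodule.sup_orthogonal_inf_of_hasOrthogonalProjection hle]
  refine sup_le le_rfl fun z hz => ?_
  obtain ⟨h1, h2⟩ := hz
  rw [← Submodule.inf_orthogonal] at h1
  have h3 := hP.eq_zero_of_orthogonal_kernelSpan hm hy (mem_Eplus.1 h2)
    (Submodule.mem_orthogonal_singleton_iff_inner_right.1 h1.1) h1.2
  rw [h3]
  exact Submodule.zero_mem _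

theorem disjoint_kernelSpan (hP : IsCliffordSystem P) {y : Euc l} (hy : y ∈ Mminus P) :
    Disjoint (Submodule.span ℝ {y}) (kernelSpan (Mminus P) y) :=
  (Submodule.orthogonal_disjoint _).mono_right ((hP.kernelSpan_le hy).trans inf_le_left)

theorem momentEnd_eq (hP : IsCliffordSystem P) {A : Module.End ℝ (Euc l)}
    (hA : A ∈ cliffordSphere P) {y : Euc l} (hyA : y ∈ Eplus A) (hy : ⟪y, y⟫_ℝ = 1) :
    y ∈ Mminus P ∧ momentEnd P y = A := by
  obtain ⟨c, hc, rfl⟩ := hP.mem_cliffordSphere.1 hA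
  rw [mem_Eplus] at hyA
  exact ⟨hP.mem_Mminus_of_comb hy hc hyA, by rw [momentEnd, hP.moment_eq hy hyA]⟩

end IsCliffordSystem

end SecondFundamentalTensor


/-! ### The isoparametric family determines the Clifford sphere -/

section Determination

variable {l m m' : ℕ} {P : Fin (m + 1) → Module.End ℝ (Euc l)}
  {Q : Fin (m' + 1) → Module.End ℝ (Euc l)}

theorem mem_level {t : ℝ} {x : Euc l} :
    x ∈ level P t ↔ ⟪x, x⟫_ℝ = 1 ∧ cartanPoly P x = t := by
  have h1 : x ∈ Metric.sphere (0 : Euc l) 1 ↔ ⟪x, x⟫_ℝ = 1 := by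
    rw [mem_sphere_zero_iff_norm, real_inner_self_eq_norm_sq,
      pow_eq_one_iff_of_nonneg (norm_nonneg x) two_ne_zero]
  rw [level, Set.mem_ofPred_eq, h1]

theorem mem_Mminus_iff_cartanPoly {x : Euc l} :
    x ∈ Mminus P ↔ ⟪x, x⟫_ℝ = 1 ∧ cartanPoly P x = -1 := mem_level

theorem continuous_cartanPoly : Continuous (cartanPoly P) := by
  have h : ∀ i, Continuous (P i) := fun i => (P i).continuous_of_finiteDimensional
  unfold cartanPoly
  fun_prop

namespace IsCliffordSystem

theorem moment_circle (hP : IsCliffordSystem P) (y n : Euc l) (c s : ℝ) (i : Fin (m + 1)) :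
    moment P (c • y + s • n) i
      = c ^ 2 * moment P y i + 2 * c * s * ⟪P i y, n⟫_ℝ + s ^ 2 * moment P n i := by
  simp only [moment, map_add, map_smul, inner_add_left, inner_add_right, real_inner_smul_left,
    real_inner_smul_right, hP.inner_left i n y, real_inner_comm (P i y) n]
  ring

/-- The Cartan polynomial restricted to a great circle is a quartic form; averaging over the
symmetries of the square leaves an affine function of `c² s²`. -/
theorem cartanPoly_circle_average (hP : IsCliffordSystem P) {y n : Euc l} (hy : ⟪y, y⟫_ℝ = 1)
    (hn : ⟪n, n⟫_ℝ = 1) (hyn : ⟪y, n⟫_ℝ = 0) :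
    ∃ a b : ℝ, ∀ c s : ℝ, c ^ 2 + s ^ 2 = 1 →
      cartanPoly P (c • y + s • n) + cartanPoly P (c • y + (-s) • n)
        + (cartanPoly P (s • y + c • n) + cartanPoly P (s • y + (-c) • n))
        = 4 * (a + b * (8 * (c ^ 2 * s ^ 2) - 1)) := by
  set A := ∑ i, moment P y i ^ 2
  set B := ∑ i, moment P n i ^ 2
  set C := ∑ i, moment P y i * moment P n i
  set D := ∑ i, ⟪P i y, n⟫_ℝ ^ 2
  refine ⟨1 - A - B + (A + B - 2 * C - 4 * D) / 4, (A + B - 2 * C - 4 * D) / 4, fun c s hcs => ?_⟩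
  have key : ∀ c s : ℝ, c ^ 2 + s ^ 2 = 1 →
      cartanPoly P (c • y + s • n) + cartanPoly P (c • y + (-s) • n)
        = 2 - 4 * (c ^ 4 * A + s ^ 4 * B + 2 * c ^ 2 * s ^ 2 * C + 4 * c ^ 2 * s ^ 2 * D) := by
    intro c s hcs
    rw [cartanPoly_eq, cartanPoly_eq, inner_circle hy hn hyn hcs,
      inner_circle hy hn hyn (by rw [neg_sq, hcs])]
    have h : ∑ i, moment P (c • y + s • n) i ^ 2 + ∑ i, moment P (c • y + (-s) • n) i ^ 2
        = 2 * (c ^ 4 * A + s ^ 4 * B + 2 * c ^ 2 * s ^ 2 * C + 4 * c ^ 2 * s ^ 2 * D) := by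
      simp only [A, B, C, D, Finset.mul_sum, ← Finset.sum_add_distrib]
      refine Finset.sum_congr rfl fun i _ => ?_
      rw [hP.moment_circle, hP.moment_circle]
      ring
    linarith
  rw [key c s hcs, key s c (by rw [add_comm, hcs])]
  have e : s ^ 2 = 1 - c ^ 2 := by linarith
  have e4 : s ^ 4 = (1 - c ^ 2) ^ 2 := by rw [← e]; ring
  rw [e4, e]
  ring

/-- The mixed term vanishes since `n ⊥ P_i y`, and `P_y n = -n` gives `n` the moment vector opposite
to that of `y`. -/
theorem moment_circle_normal (hP : IsCliffordSystem P) {y n : Euc l} (hy : y ∈ Mminus P)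
    (hn : n ∈ normalSpaceAt (Mminus P) y) (hnn : ⟪n, n⟫_ℝ = 1) (c s : ℝ) (i : Fin (m + 1)) :
    moment P (c • y + s • n) i = (c ^ 2 - s ^ 2) * moment P y i := by
  obtain ⟨h1, h2⟩ := (hP.mem_normalSpaceAt hy).1 hn
  have h3 : moment P n i = -moment P y i := by
    have h := congrArg (fun u => ⟪u, n⟫_ℝ) (hP.momentEnd_apply_apply i y n)
    simp only [inner_add_left, real_inner_smul_left, hnn] at h
    rw [hP.sphere_inner_left (hP.momentEnd_mem hy), h1, map_neg, inner_neg_right,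
      inner_neg_left] at h
    change -moment P n i + -moment P n i = _ at h
    linarith
  rw [hP.moment_circle, real_inner_comm, h2, h3]
  ring

theorem inner_normal (hP : IsCliffordSystem P) {y n : Euc l} (hy : y ∈ Mminus P)
    (hn : n ∈ normalSpaceAt (Mminus P) y) : ⟪y, n⟫_ℝ = 0 := by
  have h := ((hP.mem_normalSpaceAt hy).1 hn).2
  rw [real_inner_comm, ← hP.momentEnd_apply_self hy, momentEnd, inner_comb_right]
  simp [h]

theorem cartanPoly_circle_normal (hP : IsCliffordSystem P) {y n : Euc l} (hy : y ∈ Mminus P)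
    (hn : n ∈ normalSpaceAt (Mminus P) y) (hnn : ⟪n, n⟫_ℝ = 1) {c s : ℝ}
    (hcs : c ^ 2 + s ^ 2 = 1) :
    cartanPoly P (c • y + s • n) = 8 * (c ^ 2 * s ^ 2) - 1 := by
  rw [cartanPoly_eq, inner_circle (inner_self_mem hy) hnn (hP.inner_normal hy hn) hcs]
  simp only [hP.moment_circle_normal hy hn hnn, mul_pow, ← Finset.mul_sum, (mem_Mminus.1 hy).2]
  have e : s ^ 2 = 1 - c ^ 2 := by linarith
  rw [e]
  ring

theorem exists_mem_Eplus (hP : IsCliffordSystem P) {A : Module.End ℝ (Euc l)}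
    (hA : A ∈ cliffordSphere P) : ∃ y ∈ Eplus A, ⟪y, y⟫_ℝ = 1 := by
  by_contra! h
  have h1 : Eplus A ≤ ⊥ := mem_of_normalized fun u hu huu => (h u hu huu).elim
  have h2 := hP.finrank_Eplus hA
  rw [le_bot_iff.1 h1, finrank_bot] at h2
  exact hP.l_pos.ne h2

theorem exists_normal (hP : IsCliffordSystem P) (hm : 2 * m + 1 ≤ l) {y : Euc l}
    (hy : y ∈ Mminus P) : ∃ n ∈ normalSpaceAt (Mminus P) y, ⟪n, n⟫_ℝ = 1 := by
  by_contra! h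
  have h1 : normalSpaceAt (Mminus P) y ≤ ⊥ :=
    mem_of_normalized fun u hu huu => (h u hu huu).elim
  have h2 := hP.le_finrank_normalSpaceAt hy
  rw [le_bot_iff.1 h1, finrank_bot] at h2
  have := hP.m_pos
  omega

theorem exists_mem_Mminus (hP : IsCliffordSystem P) : ∃ y, y ∈ Mminus P := by
  obtain ⟨y, hy, hyy⟩ := hP.exists_mem_Eplus (hP.apply_mem_cliffordSphere 0)
  exact ⟨y, (hP.momentEnd_eq (hP.apply_mem_cliffordSphere 0) hy hyy).1⟩

end IsCliffordSystem

theorem exists_circle_param {u : ℝ} (hu : u ∈ Set.Ioo (-1 : ℝ) 1) :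
    ∃ c s : ℝ, c ^ 2 + s ^ 2 = 1 ∧ 8 * (c ^ 2 * s ^ 2) - 1 = u := by
  have h1 : 0 ≤ (1 - u) / 2 := by linarith [hu.2]
  -- Here `r` is to be `c² - s²`, since `8 c² s² - 1 = 1 - 2 (c² - s²)²` on the unit circle.
  set r := √((1 - u) / 2) with hr
  have hr2 : r ^ 2 = (1 - u) / 2 := Real.sq_sqrt h1
  have hr0 : 0 ≤ r := Real.sqrt_nonneg _
  have hr1 : r ≤ 1 := by nlinarith [hu.1]
  have hc : √((1 + r) / 2) ^ 2 = (1 + r) / 2 := Real.sq_sqrt (by linarith)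
  have hs : √((1 - r) / 2) ^ 2 = (1 - r) / 2 := Real.sq_sqrt (by linarith)
  refine ⟨√((1 + r) / 2), √((1 - r) / 2), ?_, ?_⟩
  · rw [hc, hs]
    ring
  · rw [hc, hs]
    linarith

namespace IsCliffordSystem

theorem exists_mem_level (hP : IsCliffordSystem P) (hm : 2 * m + 1 ≤ l) {u : ℝ}
    (hu : u ∈ Set.Ioo (-1 : ℝ) 1) : ∃ x, ⟪x, x⟫_ℝ = 1 ∧ cartanPoly P x = u := by
  obtain ⟨y, hy⟩ := hP.exists_mem_Mminus
  obtain ⟨n, hn, hnn⟩ := hP.exists_normal hm hy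
  obtain ⟨c, s, hcs, hu⟩ := exists_circle_param hu
  exact ⟨c • y + s • n, inner_circle (inner_self_mem hy) hnn (hP.inner_normal hy hn) hcs,
    by rw [hP.cartanPoly_circle_normal hy hn hnn hcs, hu]⟩

end IsCliffordSystem

theorem cartanPoly_eq_of_isoFamily_subset (h : isoFamily P ⊆ isoFamily Q) {x x' : Euc l}
    (hx : ⟪x, x⟫_ℝ = 1) (hx' : ⟪x', x'⟫_ℝ = 1) (hP : cartanPoly P x ∈ Set.Ioo (-1 : ℝ) 1)
    (he : cartanPoly P x' = cartanPoly P x) :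
    cartanPoly Q x ∈ Set.Ioo (-1 : ℝ) 1 ∧ cartanPoly Q x' = cartanPoly Q x := by
  obtain ⟨t, ht, hl⟩ := h ⟨cartanPoly P x, hP, rfl⟩
  have h1 : x ∈ level Q t := hl ▸ mem_level.2 ⟨hx, rfl⟩
  have h2 : x' ∈ level Q t := hl ▸ mem_level.2 ⟨hx', he⟩
  rw [(mem_level.1 h1).2, (mem_level.1 h2).2]
  exact ⟨ht, rfl⟩

/-- An affine function that maps `(-1, 1)` onto itself is `± id`. -/
theorem affine_eq_of_image_Ioo {a b : ℝ}
    (h1 : ∀ u ∈ Set.Ioo (-1 : ℝ) 1, a + b * u ∈ Set.Ioo (-1 : ℝ) 1)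
    (h2 : ∀ t ∈ Set.Ioo (-1 : ℝ) 1, ∃ u ∈ Set.Ioo (-1 : ℝ) 1, a + b * u = t) :
    a = 0 ∧ (b = 1 ∨ b = -1) := by
  have hclosed : ∀ u ∈ Set.Icc (-1 : ℝ) 1, a + b * u ∈ Set.Icc (-1 : ℝ) 1 := by
    intro u hu
    have hd : u ∈ closure (Set.Ioo (-1 : ℝ) 1) := by rwa [closure_Ioo (by norm_num)]
    have := map_mem_closure (f := fun u : ℝ => a + b * u) (by fun_prop) hd h1
    rwa [closure_Ioo (by norm_num)] at this
  have e1 := hclosed 1 (by norm_num)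
  have e2 := hclosed (-1) (by norm_num)
  have hb : ∀ t ∈ Set.Ioo (-1 : ℝ) 1, |t - a| ≤ |b| := by
    intro t ht
    obtain ⟨u, hu, rfl⟩ := h2 t ht
    rw [add_sub_cancel_left, abs_mul]
    exact mul_le_of_le_one_right (abs_nonneg b) (abs_le.2 ⟨hu.1.le, hu.2.le⟩)
  have hb' : ∀ t ∈ Set.Icc (-1 : ℝ) 1, |t - a| ≤ |b| := by
    intro t ht
    have hd : t ∈ closure (Set.Ioo (-1 : ℝ) 1) := by rwa [closure_Ioo (by norm_num)]
    exact closure_minimal (t := {t : ℝ | |t - a| ≤ |b|}) hb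
      (isClosed_le (by fun_prop) continuous_const) hd
  -- At the endpoints, surjectivity gives `1 + |a| ≤ |b|`, while the values staying in `[-1, 1]`
  -- give `|a| + |b| ≤ 1`.
  have e3 := hb' 1 (by norm_num)
  have e4 := hb' (-1) (by norm_num)
  obtain ⟨e11, e12⟩ := e1
  obtain ⟨e21, e22⟩ := e2
  have e5 := le_abs_self (1 - a)
  have e6 := neg_abs_le (-1 - a)
  rcases abs_cases b with ⟨hb0, hb1⟩ | ⟨hb0, hb1⟩
  · exact ⟨by linarith, Or.inl (by linarith)⟩
  · exact ⟨by linarith, Or.inr (by linarith)⟩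

namespace IsCliffordSystem

theorem exists_sign_of_isoFamily_eq (hP : IsCliffordSystem P) (hQ : IsCliffordSystem Q)
    (hm : 2 * m + 1 ≤ l) (hm' : 2 * m' + 1 ≤ l) (h : isoFamily P = isoFamily Q) :
    ∃ b : ℝ, (b = 1 ∨ b = -1) ∧ ∀ x, ⟪x, x⟫_ℝ = 1 → cartanPoly P x ∈ Set.Ioo (-1 : ℝ) 1 →
      cartanPoly Q x = b * cartanPoly P x := by
  obtain ⟨y, hy⟩ := hP.exists_mem_Mminus
  obtain ⟨n, hn, hnn⟩ := hP.exists_normal hm hy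
  have hyy := inner_self_mem hy
  have hyn := hP.inner_normal hy hn
  obtain ⟨a, b, hab⟩ := hQ.cartanPoly_circle_average hyy hnn hyn
  have key : ∀ x, ⟪x, x⟫_ℝ = 1 → cartanPoly P x ∈ Set.Ioo (-1 : ℝ) 1 →
      cartanPoly Q x = a + b * cartanPoly P x := by
    intro x hx hxP
    obtain ⟨c, s, hcs, hu⟩ := exists_circle_param hxP
    -- All four points of the average share the level of `F_P` through `x`, hence also its level of
    -- `F_Q`; the average is `F_Q` at `x`.
    have h1 : ∀ c' s' : ℝ, c' ^ 2 + s' ^ 2 = 1 → c' ^ 2 * s' ^ 2 = c ^ 2 * s ^ 2 →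
        cartanPoly Q (c' • y + s' • n) = cartanPoly Q x := fun c' s' h1 h2 =>
      (cartanPoly_eq_of_isoFamily_subset h.subset hx (inner_circle hyy hnn hyn h1) hxP
        (by rw [hP.cartanPoly_circle_normal hy hn hnn h1, h2, hu])).2
    have h2 := hab c s hcs
    rw [h1 c s hcs rfl, h1 c (-s) (by rw [neg_sq, hcs]) (by rw [neg_sq]),
      h1 s c (by rw [add_comm, hcs]) (mul_comm _ _),
      h1 s (-c) (by rw [neg_sq, add_comm, hcs]) (by rw [neg_sq, mul_comm]), hu] at h2
    linarith
  obtain ⟨ha, hb⟩ : a = 0 ∧ (b = 1 ∨ b = -1) := by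
    refine affine_eq_of_image_Ioo (fun u hu => ?_) fun t ht => ?_
    · obtain ⟨x, hx, rfl⟩ := hP.exists_mem_level hm hu
      rw [← key x hx hu]
      exact (cartanPoly_eq_of_isoFamily_subset h.subset hx hx hu rfl).1
    · obtain ⟨x, hx, rfl⟩ := hQ.exists_mem_level hm' ht
      have hu := (cartanPoly_eq_of_isoFamily_subset h.superset hx hx ht rfl).1
      exact ⟨_, hu, (key x hx hu).symm⟩
  refine ⟨b, hb, fun x hx hxP => ?_⟩
  rw [key x hx hxP, ha, zero_add]

theorem cartanPoly_le_one {x : Euc l} (hx : ⟪x, x⟫_ℝ = 1) : cartanPoly P x ≤ 1 := by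
  rw [cartanPoly_eq, hx]
  have : 0 ≤ ∑ i, moment P x i ^ 2 := Finset.sum_nonneg fun i _ => sq_nonneg _
  linarith

theorem neg_one_le_cartanPoly (hP : IsCliffordSystem P) {x : Euc l} (hx : ⟪x, x⟫_ℝ = 1) :
    -1 ≤ cartanPoly P x := by
  have h1 : ⟪momentEnd P x x, x⟫_ℝ = ∑ i, moment P x i ^ 2 := by
    rw [momentEnd, inner_comb_left]
    exact Finset.sum_congr rfl fun i _ => (sq _).symm
  have h2 : ⟪momentEnd P x x, momentEnd P x x⟫_ℝ = ∑ i, moment P x i ^ 2 := by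
    rw [momentEnd, hP.inner_comb_comb, hx, mul_one]
    exact Finset.sum_congr rfl fun i _ => (sq _).symm
  have h3 := real_inner_self_nonneg (x := momentEnd P x x - x)
  rw [inner_sub_left, inner_sub_right, inner_sub_right, real_inner_comm _ x, h1, h2, hx] at h3
  rw [cartanPoly_eq, hx]
  linarith

/-- Every point of the unit sphere lies on a great circle all of whose nearby points belong to
hypersurfaces of the family. -/
theorem exists_circle_mem_Ioo (hP : IsCliffordSystem P) (hm : 2 * m + 1 ≤ l) {x : Euc l}
    (hx : ⟪x, x⟫_ℝ = 1) (hxP : cartanPoly P x = -1 ∨ cartanPoly P x = 1) :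
    ∃ n : Euc l, ⟪n, n⟫_ℝ = 1 ∧ ⟪x, n⟫_ℝ = 0 ∧ ∀ t ∈ Set.Ioo (0 : ℝ) (Real.pi / 4),
      cartanPoly P (Real.cos t • x + Real.sin t • n) ∈ Set.Ioo (-1 : ℝ) 1 := by
  have hcs : ∀ t ∈ Set.Ioo (0 : ℝ) (Real.pi / 4),
      4 * (Real.cos t ^ 2 * Real.sin t ^ 2) ∈ Set.Ioo (0 : ℝ) 1 := by
    intro t ht
    have h1 : 4 * (Real.cos t ^ 2 * Real.sin t ^ 2) = Real.sin (2 * t) ^ 2 := by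
      rw [Real.sin_two_mul]
      ring
    have h2 : 0 < Real.sin (2 * t) :=
      Real.sin_pos_of_pos_of_lt_pi (by linarith [ht.1]) (by linarith [ht.2, Real.pi_pos])
    have h3 : 0 < Real.cos (2 * t) :=
      Real.cos_pos_of_mem_Ioo ⟨by linarith [ht.1, Real.pi_pos], by linarith [ht.2]⟩
    rw [h1]
    exact ⟨by positivity, by nlinarith [Real.sin_sq_add_cos_sq (2 * t)]⟩
  rcases hxP with hxP | hxP
  · have hxM : x ∈ Mminus P := mem_Mminus_iff_cartanPoly.2 ⟨hx, hxP⟩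
    obtain ⟨n, hn, hnn⟩ := hP.exists_normal hm hxM
    refine ⟨n, hnn, hP.inner_normal hxM hn, fun t ht => ?_⟩
    rw [hP.cartanPoly_circle_normal hxM hn hnn (Real.cos_sq_add_sin_sq t)]
    have := hcs t ht
    exact ⟨by linarith [this.1], by linarith [this.2]⟩
  · have h0 : ∀ i, moment P x i = 0 := by
      rw [cartanPoly_eq, hx] at hxP
      have h1 : ∑ i, moment P x i ^ 2 = 0 := by linarith
      exact fun i => pow_eq_zero_iff two_ne_zero |>.1
        ((Finset.sum_eq_zero_iff_of_nonneg fun i _ => sq_nonneg (moment P x i)).1 h1 i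
          (Finset.mem_univ i))
    have hn : ⟪P 0 x, P 0 x⟫_ℝ = 1 := by rw [hP.inner_apply_apply, if_pos rfl, hx]
    have hxn : ⟪x, P 0 x⟫_ℝ = 0 := by
      rw [← hP.inner_left]
      exact h0 0
    refine ⟨P 0 x, hn, hxn, fun t ht => ?_⟩
    -- Both `x` and `P 0 x` have zero moment vector, so only the mixed term `2 cos t sin t` in the
    -- coordinate 0 survives.
    have h1 : ∀ i, moment P (Real.cos t • x + Real.sin t • P 0 x) i ^ 2
        = if i = 0 then 4 * (Real.cos t ^ 2 * Real.sin t ^ 2) else 0 := by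
      intro i
      have h2 : moment P (P 0 x) i = 0 := by
        have h3 := hP.anticomm_apply i 0 x
        have h4 : moment P (P 0 x) i = ⟪x, P 0 (P i (P 0 x))⟫_ℝ := by
          rw [← hP.inner_left, real_inner_comm]
          rfl
        split_ifs at h3 with hi
        · subst hi
          rw [h4, hP.sq_apply, hxn]
        · rw [h4, eq_neg_of_add_eq_zero_left h3, map_neg, hP.sq_apply, inner_neg_right,
            ← hP.inner_left]
          exact neg_eq_zero.2 (h0 i)
      rw [hP.moment_circle, h0, h2, hP.inner_apply_apply, hx]
      split_ifs
      · ring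
      · ring
    rw [cartanPoly_eq, inner_circle hx hn hxn (Real.cos_sq_add_sin_sq t)]
    simp only [h1, Finset.sum_ite_eq', Finset.mem_univ, if_true]
    have := hcs t ht
    exact ⟨by linarith [this.2], by linarith [this.1]⟩

theorem cartanPoly_eq_or_neg_of_isoFamily_eq (hP : IsCliffordSystem P) (hQ : IsCliffordSystem Q)
    (hm : 2 * m + 1 ≤ l) (hm' : 2 * m' + 1 ≤ l) (h : isoFamily P = isoFamily Q) :
    (∀ x, ⟪x, x⟫_ℝ = 1 → cartanPoly Q x = cartanPoly P x) ∨
      ∀ x, ⟪x, x⟫_ℝ = 1 → cartanPoly Q x = -cartanPoly P x := by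
  obtain ⟨b, hb, key⟩ := hP.exists_sign_of_isoFamily_eq hQ hm hm' h
  have hall : ∀ x, ⟪x, x⟫_ℝ = 1 → cartanPoly Q x = b * cartanPoly P x := by
    intro x hx
    by_cases hxP : cartanPoly P x ∈ Set.Ioo (-1 : ℝ) 1
    · exact key x hx hxP
    have hxP' : cartanPoly P x = -1 ∨ cartanPoly P x = 1 := by
      by_contra! hne
      exact hxP ⟨lt_of_le_of_ne (hP.neg_one_le_cartanPoly hx) hne.1.symm,
        lt_of_le_of_ne (cartanPoly_le_one hx) hne.2⟩
    obtain ⟨n, hn, hxn, hc⟩ := hP.exists_circle_mem_Ioo hm hx hxP'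
    have hcont : Continuous fun t : ℝ =>
        cartanPoly Q (Real.cos t • x + Real.sin t • n)
          - b * cartanPoly P (Real.cos t • x + Real.sin t • n) := by
      have hγ : Continuous fun t : ℝ => Real.cos t • x + Real.sin t • n := by fun_prop
      exact (continuous_cartanPoly.comp hγ).sub
        (continuous_const.mul (continuous_cartanPoly.comp hγ))
    have h0 : (0 : ℝ) ∈ closure (Set.Ioo (0 : ℝ) (Real.pi / 4)) := by
      have hpi := Real.pi_pos
      rw [closure_Ioo (by positivity)]
      exact ⟨le_rfl, by positivity⟩
    -- The relation holds at the nearby points of the circle, where `F_P` lies in `(-1, 1)`, and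
    -- passes to `t = 0` by continuity.
    have h1 := closure_minimal (t := {t : ℝ | cartanPoly Q (Real.cos t • x + Real.sin t • n)
          - b * cartanPoly P (Real.cos t • x + Real.sin t • n) = 0})
        (fun t ht => sub_eq_zero.2
          (key _ (inner_circle hx hn hxn (Real.cos_sq_add_sin_sq t)) (hc t ht)))
        (isClosed_eq hcont continuous_const) h0
    simpa [sub_eq_zero] using h1
  rcases hb with rfl | rfl
  · exact Or.inl fun x hx => by rw [hall x hx, one_mul]
  · exact Or.inr fun x hx => by rw [hall x hx, neg_one_mul]

/-- The decomposition of `E_+` at a point `y` refers only to `y` and the set `M_-`, so both systems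
have the same eigenspace there. -/
theorem Eplus_image_subset_of_Mminus_eq (hP : IsCliffordSystem P) (hQ : IsCliffordSystem Q)
    (hm : 2 * m + 1 ≤ l) (hm' : 2 * m' + 1 ≤ l) (h : Mminus P = Mminus Q) :
    Eplus '' cliffordSphere P ⊆ Eplus '' cliffordSphere Q := by
  rintro _ ⟨A, hA, rfl⟩
  obtain ⟨y, hyA, hyy⟩ := hP.exists_mem_Eplus hA
  obtain ⟨hy, rfl⟩ := hP.momentEnd_eq hA hyA hyy
  have hyQ : y ∈ Mminus Q := h ▸ hy
  exact ⟨_, hQ.momentEnd_mem hyQ, by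
    rw [hP.Eplus_eq_sup_kernelSpan hm hy, hQ.Eplus_eq_sup_kernelSpan hm' hyQ, h]⟩

theorem cliffordSphere_eq_of_Eplus_image_eq (hP : IsCliffordSystem P) (hQ : IsCliffordSystem Q)
    (h : Eplus '' cliffordSphere P = Eplus '' cliffordSphere Q) :
    cliffordSphere P = cliffordSphere Q :=
  (hP.cliffordSphere_subset_of_Eplus_image hQ h.subset).antisymm
    (hQ.cliffordSphere_subset_of_Eplus_image hP h.superset)

/-- If `-F` is the polynomial of a second system, the two systems anticommute. -/
theorem anticomm_of_cartanPoly_neg (hP : IsCliffordSystem P) (hQ : IsCliffordSystem Q)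
    (h : ∀ x, ⟪x, x⟫_ℝ = 1 → cartanPoly Q x = -cartanPoly P x) {A : Module.End ℝ (Euc l)}
    (hA : A ∈ cliffordSphere P) (j : Fin (m' + 1)) (x : Euc l) : A (Q j x) = -Q j (A x) := by
  have key : ∀ A ∈ cliffordSphere P, ∀ u ∈ Eplus A, A (Q j u) = -Q j u := by
    intro A hA u hu
    -- Unit vectors of `E_+(A)` have `F_P = -1`, hence `F_Q = 1`, so every `⟨Q_j w, w⟩` vanishes.
    -- Polarization then shows that `Q j` maps `E_+(A)` into `E_-(A)`.
    have hiso : ∀ w ∈ Eplus A, ⟪Q j w, w⟫_ℝ = 0 := by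
      have h1 : ∀ w ∈ Eplus A, ⟪w, w⟫_ℝ = 1 → ⟪Q j w, w⟫_ℝ = 0 := by
        intro w hw hww
        have h2 := h w hww
        rw [(mem_Mminus_iff_cartanPoly.1 (hP.momentEnd_eq hA hw hww).1).2, neg_neg,
          cartanPoly_eq, hww] at h2
        have h3 : ∑ i, moment Q w i ^ 2 = 0 := by linarith
        exact pow_eq_zero_iff two_ne_zero |>.1
          ((Finset.sum_eq_zero_iff_of_nonneg fun i _ => sq_nonneg (moment Q w i)).1 h3 j
            (Finset.mem_univ j))
      intro w hw
      rcases eq_or_ne w 0 with rfl | hw0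
      · simp
      have hn : ‖w‖ ≠ 0 := norm_ne_zero_iff.2 hw0
      have h2 := h1 (‖w‖⁻¹ • w) (Submodule.smul_mem _ _ hw) (by
        rw [real_inner_smul_left, real_inner_smul_right, real_inner_self_eq_norm_sq]
        field_simp)
      rw [map_smul, real_inner_smul_left, real_inner_smul_right] at h2
      simpa [hn] using h2
    rw [← hP.mem_Eplus_orthogonal hA, Submodule.mem_orthogonal']
    intro w hw
    have h1 := hiso _ (Submodule.add_mem _ hu hw)
    rw [map_add, inner_add_left, inner_add_right, inner_add_right, hiso u hu, hiso w hw,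
      hQ.inner_left j w u, real_inner_comm (Q j u) w] at h1
    linarith
  -- The sphere contains `-A` as well, so both eigenspaces of `A` are interchanged by `Q j`; `x ± A
  -- x` are the components of `x`, up to the factor 2.
  have h1 := key A hA (x + A x)
    (by rw [mem_Eplus, map_add, hP.sphere_sq_apply hA, add_comm])
  have h2 := key (-A) (hP.neg_mem_cliffordSphere hA) (x - A x)
    (by simp [mem_Eplus, hP.sphere_sq_apply hA])
  simp only [map_add, map_sub, LinearMap.neg_apply] at h1 h2
  have h3 : (2 : ℝ) • A (Q j x) = (2 : ℝ) • -Q j (A x) := by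
    have h4 : (2 : ℝ) • A (Q j x) =
      (A (Q j x) + A (Q j (A x))) - (-A (Q j x) - -A (Q j (A x))) := by module
    rw [h4, h1, h2]
    module
  exact smul_right_injective _ (two_ne_zero' ℝ) h3

/-- No unit normal `n` at `y ∈ M_-` is orthogonal to all `Q_j y`, so the normal space, of dimension
at least `l - m`, meets the complement of a space of dimension at most `m' + 1` trivially. -/
theorem le_of_cartanPoly_neg (hP : IsCliffordSystem P) (hQ : IsCliffordSystem Q)
    (h : ∀ x, ⟪x, x⟫_ℝ = 1 → cartanPoly Q x = -cartanPoly P x) : l ≤ m + m' + 1 := by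
  obtain ⟨y, hy⟩ := hP.exists_mem_Mminus
  have hyy := inner_self_mem hy
  have hy0 : ∀ j, moment Q y j = 0 := by
    have h2 := h y hyy
    rw [(mem_Mminus_iff_cartanPoly.1 hy).2, neg_neg, cartanPoly_eq, hyy] at h2
    have h3 : ∑ i, moment Q y i ^ 2 = 0 := by linarith
    exact fun j => pow_eq_zero_iff two_ne_zero |>.1
      ((Finset.sum_eq_zero_iff_of_nonneg fun i _ => sq_nonneg (moment Q y i)).1 h3 j
        (Finset.mem_univ j))
  have hbot : normalSpaceAt (Mminus P) y ⊓ (orbitSpan Q y)ᗮ ≤ ⊥ := by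
    refine mem_of_normalized fun n hn hnn => ?_
    obtain ⟨hn, hnQ⟩ := hn
    rw [SetLike.mem_coe, mem_orbitSpan_orthogonal] at hnQ
    have h1 : ∀ c s : ℝ, c ^ 2 + s ^ 2 = 1 →
        1 - 2 * (s ^ 4 * ∑ j, moment Q n j ^ 2) = -(8 * (c ^ 2 * s ^ 2) - 1) := by
      intro c s hcs
      have hu := inner_circle hyy hnn (hP.inner_normal hy hn) hcs
      have h2 := h _ hu
      rw [hP.cartanPoly_circle_normal hy hn hnn hcs, cartanPoly_eq, hu] at h2
      have h3 : ∀ j, moment Q (c • y + s • n) j ^ 2 = s ^ 4 * moment Q n j ^ 2 := fun j => by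
        rw [hQ.moment_circle, hy0, real_inner_comm, hnQ]
        ring
      simp only [h3, ← Finset.mul_sum] at h2
      linarith
    -- The relation reads `s² ∑ ⟨Q_j n, n⟩² = 4 c²` for `s ≠ 0`; two points with different `c² / s²`
    -- contradict each other.
    have h2 := h1 (3 / 5) (4 / 5) (by norm_num)
    have h3 := h1 (4 / 5) (3 / 5) (by norm_num)
    exfalso
    linarith
  have h1 := Submodule.finrank_sup_add_finrank_inf_eq (normalSpaceAt (Mminus P) y)
    (orbitSpan Q y)ᗮ
  rw [le_bot_iff.1 hbot, finrank_bot] at h1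
  have h2 := Submodule.finrank_le (normalSpaceAt (Mminus P) y ⊔ (orbitSpan Q y)ᗮ)
  have h3 := (orbitSpan Q y).finrank_add_finrank_orthogonal
  have h4 : Module.finrank ℝ (orbitSpan Q y) ≤ m' + 1 := finrank_orbitSpan_le y
  have h5 := hP.le_finrank_normalSpaceAt hy
  omega

end IsCliffordSystem

/-- Taking determinants, `(det J)² = (-1) ^ dim V` must be nonnegative. -/
theorem even_finrank_of_sq_eq_neg_one {V : Type*} [AddCommGroup V] [Module ℝ V]
    (J : Module.End ℝ V) (hJ : J * J = -1) : Even (Module.finrank ℝ V) := by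
  have h1 := congrArg LinearMap.det hJ
  have h2 : (-1 : Module.End ℝ V) = (-1 : ℝ) • 1 := by simp
  rw [map_mul, h2, LinearMap.det_smul, map_one, mul_one] at h1
  by_contra hodd
  rw [Nat.not_even_iff_odd] at hodd
  rw [hodd.neg_one_pow] at h1
  linarith [mul_self_nonneg (LinearMap.det J)]

namespace IsCliffordSystem

theorem not_cartanPoly_neg (hP : IsCliffordSystem P) (hQ : IsCliffordSystem Q)
    (hm : 2 * m + 1 ≤ l) (hm' : 2 * m' + 1 ≤ l) :
    ¬ ∀ x, ⟪x, x⟫_ℝ = 1 → cartanPoly Q x = -cartanPoly P x := by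
  intro h
  have h1 := hP.le_of_cartanPoly_neg hQ h
  have hpos := hP.m_pos
  let k : Fin (m + 1) := ⟨1, by omega⟩
  have hk : (0 : Fin (m + 1)) ≠ k := fun hk => by simpa [k] using congrArg Fin.val hk
  have hanti := fun {A : Module.End ℝ (Euc l)} (hA : A ∈ cliffordSphere P) =>
    hP.anticomm_of_cartanPoly_neg hQ h hA 0
  have h0k : ∀ x, P 0 (P k x) = -P k (P 0 x) := fun x => by
    have h2 := hP.anticomm_apply 0 k x
    rw [if_neg hk] at h2
    exact eq_neg_of_add_eq_zero_left h2
  have hmaps : ∀ x ∈ Eplus (P 0), (P k * Q 0) x ∈ Eplus (P 0) := by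
    intro x hx
    rw [mem_Eplus] at hx ⊢
    rw [Module.End.mul_apply, h0k, hanti (hP.apply_mem_cliffordSphere 0), hx, map_neg, neg_neg]
  have heven := even_finrank_of_sq_eq_neg_one ((P k * Q 0).restrict hmaps) (by
    refine LinearMap.ext fun x => Subtype.ext ?_
    change P k (Q 0 (P k (Q 0 (x : Euc l)))) = -(x : Euc l)
    rw [hanti (hP.apply_mem_cliffordSphere k), hP.sq_apply, hQ.sq_apply])
  rw [hP.finrank_Eplus (hP.apply_mem_cliffordSphere 0)] at heven
  -- The bound `l ≤ m + m' + 1` is compatible with `2m + 1 ≤ l` and `2m' + 1 ≤ l` only when all are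
  -- equalities.
  have hl : l = 2 * m + 1 := by omega
  exact Nat.not_even_iff_odd.2 ⟨m, hl⟩ heven

theorem cliffordSphere_eq_of_isoFamily_eq (hP : IsCliffordSystem P) (hQ : IsCliffordSystem Q)
    (hm : 2 * m + 1 ≤ l) (hm' : 2 * m' + 1 ≤ l) (h : isoFamily P = isoFamily Q) :
    cliffordSphere P = cliffordSphere Q := by
  have h1 := (hP.cartanPoly_eq_or_neg_of_isoFamily_eq hQ hm hm' h).resolve_right
    (hP.not_cartanPoly_neg hQ hm hm')
  have hM : Mminus P = Mminus Q := by
    ext x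
    rw [mem_Mminus_iff_cartanPoly, mem_Mminus_iff_cartanPoly]
    exact and_congr_right fun hx => by rw [h1 x hx]
  exact hP.cliffordSphere_eq_of_Eplus_image_eq hQ
    ((hP.Eplus_image_subset_of_Mminus_eq hQ hm hm' hM).antisymm
      (hQ.Eplus_image_subset_of_Mminus_eq hP hm' hm hM.symm))

end IsCliffordSystem

end Determination


/-! ### Congruent families and geometric equivalence -/

section Congruence

variable {l m m' : ℕ} {P : Fin (m + 1) → Module.End ℝ (Euc l)}
  {Q : Fin (m' + 1) → Module.End ℝ (Euc l)}

/-- The system `A P_i Aᵗ`. -/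
noncomputable def conjSystem (A : Euc l ≃ₗᵢ[ℝ] Euc l) (P : Fin (m + 1) → Module.End ℝ (Euc l)) :
    Fin (m + 1) → Module.End ℝ (Euc l) :=
  fun i => A.toLinearEquiv.conj (P i)

theorem conjSystem_apply (A : Euc l ≃ₗᵢ[ℝ] Euc l) (i : Fin (m + 1)) (x : Euc l) :
    conjSystem A P i x = A (P i (A.symm x)) := rfl

theorem conjSystem_symm_conjSystem (A : Euc l ≃ₗᵢ[ℝ] Euc l) :
    conjSystem A.symm (conjSystem A P) = P := by
  ext1 i
  ext1 x
  simp [conjSystem_apply]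

theorem IsCliffordSystem.conjSystem (hP : IsCliffordSystem P) (A : Euc l ≃ₗᵢ[ℝ] Euc l) :
    IsCliffordSystem (conjSystem A P) where
  l_pos := hP.l_pos
  m_pos := hP.m_pos
  symmetric i x y := by
    rw [conjSystem_apply, conjSystem_apply, ← A.symm.inner_map_map, A.symm_apply_apply,
      hP.inner_left, ← A.inner_map_map, A.apply_symm_apply]
  anticomm i j := by
    refine LinearMap.ext fun x => ?_
    have h := congrArg A (hP.anticomm_apply i j (A.symm x))
    rw [map_add] at h
    simp only [LinearMap.add_apply, Module.End.mul_apply, conjSystem_apply, A.symm_apply_apply]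
    rw [h]
    split_ifs
    · simp [two_smul]
    · simp

theorem cartanPoly_conjSystem (A : Euc l ≃ₗᵢ[ℝ] Euc l) (x : Euc l) :
    cartanPoly (conjSystem A P) (A x) = cartanPoly P x := by
  simp only [cartanPoly, conjSystem_apply, A.symm_apply_apply, A.inner_map_map]

theorem level_conjSystem (A : Euc l ≃ₗᵢ[ℝ] Euc l) (t : ℝ) :
    level (conjSystem A P) t = A '' level P t := by
  ext x
  constructor
  · intro hx
    refine ⟨A.symm x, ?_, A.apply_symm_apply x⟩
    rw [mem_level] at hx ⊢
    rwa [A.symm.inner_map_map, ← cartanPoly_conjSystem A, A.apply_symm_apply]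
  · rintro ⟨x, hx, rfl⟩
    rw [mem_level] at hx ⊢
    rwa [A.inner_map_map, cartanPoly_conjSystem]

theorem isoFamily_conjSystem (A : Euc l ≃ₗᵢ[ℝ] Euc l) :
    isoFamily (conjSystem A P) = (fun M : Set (Euc l) => A '' M) '' isoFamily P := by
  ext M
  constructor
  · rintro ⟨t, ht, rfl⟩
    exact ⟨_, ⟨t, ht, rfl⟩, (level_conjSystem A t).symm⟩
  · rintro ⟨_, ⟨t, ht, rfl⟩, rfl⟩
    exact ⟨t, ht, (level_conjSystem A t).symm⟩

namespace IsCliffordSystem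

theorem linearIndependent (hP : IsCliffordSystem P) : LinearIndependent ℝ P := by
  rw [Fintype.linearIndependent_iff]
  intro c hc i
  have h := hP.traceInner_comb c c
  rw [show comb P c = 0 from hc] at h
  simp only [traceInner, mul_zero, map_zero, zero_div] at h
  exact mul_self_eq_zero.1 ((Finset.sum_eq_zero_iff_of_nonneg
    fun i _ => mul_self_nonneg (c i)).1 h.symm i (Finset.mem_univ i))

theorem cliffordSpan_le_of_cliffordSphere_subset (hP : IsCliffordSystem P)
    (h : cliffordSphere P ⊆ cliffordSphere Q) : cliffordSpan P ≤ cliffordSpan Q := by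
  rw [cliffordSpan, Submodule.span_le]
  rintro _ ⟨i, rfl⟩
  exact (h (hP.apply_mem_cliffordSphere i)).1

theorem finrank_cliffordSpan (hP : IsCliffordSystem P) :
    Module.finrank ℝ (cliffordSpan P) = m + 1 := by
  have h := finrank_span_eq_card hP.linearIndependent
  rwa [Fintype.card_fin] at h

/-- Both systems are orthonormal bases of the common span for `traceInner`, so the change of basis
is orthogonal. -/
theorem exists_orthogonal_of_cliffordSpan_eq {R : Fin (m + 1) → Module.End ℝ (Euc l)}
    (hP : IsCliffordSystem P) (hR : IsCliffordSystem R) (h : cliffordSpan P = cliffordSpan R) :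
    ∃ B : cliffordSpan P ≃ₗ[ℝ] cliffordSpan P,
      (∀ X Y : cliffordSpan P,
        traceInner (B X : Module.End ℝ (Euc l)) (B Y : Module.End ℝ (Euc l))
          = traceInner (X : Module.End ℝ (Euc l)) (Y : Module.End ℝ (Euc l))) ∧
      ∀ i, (B ⟨P i, Submodule.subset_span (Set.mem_range_self i)⟩ : Module.End ℝ (Euc l))
        = R i := by
  let b : Module.Basis (Fin (m + 1)) ℝ (cliffordSpan P) := Module.Basis.span hP.linearIndependent
  let b' : Module.Basis (Fin (m + 1)) ℝ (cliffordSpan R) := Module.Basis.span hR.linearIndependent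
  have hb : ∀ i, b i = ⟨P i, Submodule.subset_span (Set.mem_range_self i)⟩ := fun i =>
    Module.Basis.span_apply hP.linearIndependent i
  have hb' : ∀ i, (b' i : Module.End ℝ (Euc l)) = R i := fun i =>
    congrArg Subtype.val (Module.Basis.span_apply hR.linearIndependent i)
  let B := (b.equiv b' (Equiv.refl _)).trans (LinearEquiv.ofEq _ _ h.symm)
  have hB : ∀ i, (B ⟨P i, Submodule.subset_span (Set.mem_range_self i)⟩ : Module.End ℝ (Euc l))
      = R i := fun i => by
    rw [← hb]
    simp [B, hb']
  have hcomb : ∀ X : cliffordSpan P, (X : Module.End ℝ (Euc l)) = comb P (b.repr X) ∧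
      (B X : Module.End ℝ (Euc l)) = comb R (b.repr X) := by
    intro X
    constructor
    · nth_rewrite 1 [← b.sum_repr X]
      simp [comb, hb]
    · nth_rewrite 1 [← b.sum_repr X]
      simp only [comb, map_sum, map_smul, hb, Submodule.coe_sum, Submodule.coe_smul, hB]
  refine ⟨B, fun X Y => ?_, hB⟩
  rw [(hcomb X).1, (hcomb X).2, (hcomb Y).1, (hcomb Y).2, hP.traceInner_comb, hR.traceInner_comb]

theorem geometricallyEquivalent {Q : Fin (m + 1) → Module.End ℝ (Euc l)}
    (hP : IsCliffordSystem P) (hQ : IsCliffordSystem Q) (A : Euc l ≃ₗᵢ[ℝ] Euc l)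
    (h : cliffordSpan (FKM.conjSystem A P) = cliffordSpan Q) : GeometricallyEquivalent P Q := by
  have hspan : ∀ (S : Fin (m + 1) → Module.End ℝ (Euc l)) (C : Euc l ≃ₗᵢ[ℝ] Euc l),
      cliffordSpan (FKM.conjSystem C S)
        = (cliffordSpan S).map (C.toLinearEquiv.conj : _ →ₗ[ℝ] Module.End ℝ (Euc l)) := by
    intro S C
    rw [cliffordSpan, cliffordSpan, Submodule.map_span, ← Set.range_comp]
    rfl
  -- The transformation `B` has to act on the span of `P`, so `Q` is pulled back by `A` and compared
  -- with `P` there.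
  have h1 : cliffordSpan P = cliffordSpan (FKM.conjSystem A.symm Q) := by
    rw [hspan, ← h, ← hspan, conjSystem_symm_conjSystem]
  obtain ⟨B, hB, hBP⟩ := hP.exists_orthogonal_of_cliffordSpan_eq (hQ.conjSystem A.symm) h1
  refine ⟨B, hB, A, fun i x => ?_⟩
  simp [hBP, conjSystem_apply]

end IsCliffordSystem

end Congruence

end FKM

theorem theorem4p6 {l m : ℕ} (P : Fin (m + 1) → Module.End ℝ (FKM.Euc l))
    (hP : FKM.IsCliffordSystem P) (hm : (m : ℤ) ≤ (l : ℤ) - m - 1) :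
    -- the eigenspaces `E_+(A)`, `A ∈ Σ`, in terms of the second fundamental tensors of `M_-`
    (∀ A ∈ FKM.cliffordSphere P, ∀ y ∈ FKM.Eplus A, y ∈ Metric.sphere (0 : FKM.Euc l) 1 →
      y ∈ FKM.Mminus P ∧
      -- the tensors `S_N` are well defined
      (∀ N ∈ FKM.normalSpaceAt (FKM.Mminus P) y,
        (∃ ξ, FKM.IsNormalField (FKM.Mminus P) y N ξ) ∧
        ∀ ξ, FKM.IsNormalField (FKM.Mminus P) y N ξ →
          FKM.secondFundamentalTensor (FKM.Mminus P) y N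
            = FKM.weingarten (FKM.Mminus P) y ξ) ∧
      -- the direct sum decomposition
      FKM.Eplus A = Submodule.span ℝ {y} ⊔ FKM.kernelSpan (FKM.Mminus P) y ∧
      Disjoint (Submodule.span ℝ {y}) (FKM.kernelSpan (FKM.Mminus P) y)) ∧
    -- the set of the eigenspaces determines the Clifford sphere and the family
    (∀ (m' : ℕ) (Q : Fin (m' + 1) → Module.End ℝ (FKM.Euc l)), FKM.IsCliffordSystem Q →
      FKM.Eplus '' FKM.cliffordSphere P = FKM.Eplus '' FKM.cliffordSphere Q →
      FKM.cliffordSphere P = FKM.cliffordSphere Q ∧ FKM.isoFamily P = FKM.isoFamily Q) ∧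
    -- the family determines the Clifford sphere
    (∀ (m' : ℕ) (Q : Fin (m' + 1) → Module.End ℝ (FKM.Euc l)), FKM.IsCliffordSystem Q →
      (m' : ℤ) ≤ (l : ℤ) - m' - 1 →
      FKM.isoFamily P = FKM.isoFamily Q →
      FKM.cliffordSphere P = FKM.cliffordSphere Q) ∧
    -- the congruence class of the family determines the geometric equivalence class
    (∀ (m' : ℕ) (Q : Fin (m' + 1) → Module.End ℝ (FKM.Euc l)), FKM.IsCliffordSystem Q →
      (m' : ℤ) ≤ (l : ℤ) - m' - 1 →
      FKM.Congruent (FKM.isoFamily P) (FKM.isoFamily Q) →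
      ∃ h : m = m', FKM.GeometricallyEquivalent P
        (fun i => Q (Fin.cast (congrArg (· + 1) h) i))) := by
  have hml : 2 * m + 1 ≤ l := by omega
  refine ⟨?_, ?_, ?_, ?_⟩
  · intro A hA y hyA hy
    have hyy : inner ℝ y y = 1 := by
      rw [real_inner_self_eq_norm_sq, mem_sphere_zero_iff_norm.1 hy, one_pow]
    obtain ⟨hyM, rfl⟩ := hP.momentEnd_eq hA hyA hyy
    exact ⟨hyM, fun N hN => ⟨hP.exists_isNormalField hyM hN,
      fun ξ hξ => hP.secondFundamentalTensor_eq hyM hξ⟩,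
      hP.Eplus_eq_sup_kernelSpan hml hyM, hP.disjoint_kernelSpan hyM⟩
  · intro m' Q hQ h
    have hS := hP.cliffordSphere_eq_of_Eplus_image_eq hQ h
    exact ⟨hS, hP.isoFamily_eq_of_cliffordSphere_eq hQ hS⟩
  · intro m' Q hQ hm' h
    exact hP.cliffordSphere_eq_of_isoFamily_eq hQ hml (by omega) h
  · rintro m' Q hQ hm' ⟨A, hA⟩
    have hPA := hP.conjSystem A
    rw [← FKM.isoFamily_conjSystem] at hA
    have hS := hPA.cliffordSphere_eq_of_isoFamily_eq hQ hml (by omega) hA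
    have hspan := (hPA.cliffordSpan_le_of_cliffordSphere_subset hS.subset).antisymm
      (hQ.cliffordSpan_le_of_cliffordSphere_subset hS.superset)
    -- The number of endomorphisms is the dimension of the common span.
    have hmm : m = m' := by
      have h1 := hPA.finrank_cliffordSpan
      rw [hspan, hQ.finrank_cliffordSpan] at h1
      omega
    subst hmm
    exact ⟨rfl, hP.geometricallyEquivalent hQ A hspan⟩
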